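/- There is an absolute constant $C>0$ such that the following holds. **The estimator.** Let $G$ be a distribution of bids on $\mathbb{R}$ whose bid (quantile) function $b=G^{-1}$ is well defined and continuously differentiable on $[0,1]$, i.e. $G(b(q))=q$ for all $q\in[0,1]$ (so $b$ is strictly increasing). From $N\ge 1$ independent samples of $G$, sorted as $b_{(1)}\le\dots\le b_{(N)}$, define the empirical quantile estimator by $\hat b(q)=b_{(i)}$ for $q\in[\frac{i-1}{N},\frac{i}{N})$, $1\le i\le N$, and let $$\mathrm{MSE}_N[b]=\mathbb{E}\Big[\sup_{q\in[0,1)}|b(q)-\hat b(q)|^2\Big]^{1/2}.$$ Then the rate of convergence is $\sqrt N$, i.e. for fixed $b$ we have $\sqrt N\cdot \mathrm{MSE}_N[b]=\Theta(1)$ as $N\to\infty$, and for every $N\ge1$ $$\mathrm{MSE}_N[b]\le C\,\frac{\sup_{q\in(0,1)} b'(q)}{\sqrt{2N}}.$$ **Rank-based auctions.** Consider $n\ge 2$ agents whose values are drawn independently from a distribution $F$ on $[0,1]$ with continuous (strictly increasing) inverse $v=F^{-1}:[0,1]\to[0,1]$. In a rank-based auction with weights $w_1,\dots,w_n\in[0,1]$,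 not all zero, the agents are ranked by decreasing bid (bids are nonnegative reals, ties are broken uniformly at random) and the agent of rank $k$ is served with probability $w_k$. In the first-price format an agent pays his bid if he is served; in the all-pay format he always pays his bid. An agent's utility is his value times his probability of service minus his expected payment. Let $s$ be a measurable strategy which, played by all agents, is a Bayes–Nash equilibrium (for every value $t$ in the support of $F$, the bid $s(t)$ is nonnegative and maximizes the interim expected utility over all nonnegative bids), and suppose that $b(q)=s(v(q))$ is strictly increasing and continuously differentiable on $[0,1]$. Let $x(q)$ be the interim probability of service of an agent who bids $b(q)$ against $n-1$ agents who play $s$. If the $N\ge1$ samples are drawn independently from the distribution of the bid $s(t)$, $t\sim F$, then (i) if the auction has the first-price format, $$\mathrm{MSE}_N[b]\le C\,\frac{\sup_{q\in(0,1)}\{x'(q)/x(q)\}}{\sqrt{2N}};$$ (ii) if the auction has the all-pay format, $$\mathrm{MSE}_N[b]\le C\,\frac{\sup_{q\in(0,1)}x'(q)}{\sqrt{2N}}.$$ (The supremum in (i) may be $+\infty$, in which case the bound holds trivially.) -/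

import Mathlib

open MeasureTheory ProbabilityTheory Set Filter
open scoped ENNReal

noncomputable section

namespace BidInference

/-! ## Auctions and Bayes-Nash equilibrium -/

/-- A (sealed-bid) auction with `n` agents: for every bid vector, the probability with which each
agent is served and the expected payment of each agent. -/
structure Auction (n : ℕ) where
  alloc : (Fin n → ℝ) → Fin n → ℝ
  pay : (Fin n → ℝ) → Fin n → ℝ

/-- The number of agents who bid strictly more than agent `i`. -/
def numAbove {n : ℕ} (bids : Fin n → ℝ) (i : Fin n) : ℕ :=
  (Finset.univ.filter fun j => bids i < bids j).card

/-- The number of agents (agent `i` included) who bid the same as agent `i`. -/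
def numTied {n : ℕ} (bids : Fin n → ℝ) (i : Fin n) : ℕ :=
  (Finset.univ.filter fun j => bids j = bids i).card

/-- Rank-based allocation: the agents are ranked by decreasing bid, ties being broken uniformly at
random, and the agent of rank `k` (counted from `0`) is served with probability `w k`. Agent `i` is
thus equally likely to get each of the ranks `a, …, a + t - 1`, where `a` is the number of agents
above `i` and `t` is the number of agents tied with `i`. -/
def rankAlloc {n : ℕ} (w : Fin n → ℝ) (bids : Fin n → ℝ) (i : Fin n) : ℝ :=
  (∑ k ∈ Finset.univ.filter
      (fun k : Fin n => numAbove bids i ≤ (k : ℕ) ∧ (k : ℕ) < numAbove bids i + numTied bids i), w k)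
    / (numTied bids i : ℝ)

/-- The rank-based auction with the first-price format: an agent pays his bid upon winning. -/
def firstPrice {n : ℕ} (w : Fin n → ℝ) : Auction n where
  alloc := rankAlloc w
  pay := fun bids i => bids i * rankAlloc w bids i

/-- The rank-based auction with the all-pay format: an agent always pays his bid. -/
def allPay {n : ℕ} (w : Fin n → ℝ) : Auction n where
  alloc := rankAlloc w
  pay := fun bids i => bids i

/-- Interim allocation of agent `i` with bid `z`: the values of the other agents are drawn
independently from `F` and they bid according to the strategy profile `s` (the value drawn for
agent `i` himself is not used). -/
def interimAlloc {n : ℕ} (A : Auction n) (F : Measure ℝ) (s : Fin n → ℝ → ℝ) (i : Fin n) (z : ℝ) :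
    ℝ :=
  ∫ vals : Fin n → ℝ, A.alloc (Function.update (fun j => s j (vals j)) i z) i
    ∂(Measure.pi fun _ => F)

/-- Interim payment of agent `i` with bid `z`. -/
def interimPay {n : ℕ} (A : Auction n) (F : Measure ℝ) (s : Fin n → ℝ → ℝ) (i : Fin n) (z : ℝ) :
    ℝ :=
  ∫ vals : Fin n → ℝ, A.pay (Function.update (fun j => s j (vals j)) i z) i
    ∂(Measure.pi fun _ => F)

/-- Interim utility of agent `i` with value `t` and bid `z`. -/
def interimUtility {n : ℕ} (A : Auction n) (F : Measure ℝ) (s : Fin n → ℝ → ℝ) (i : Fin n)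
    (t z : ℝ) : ℝ :=
  t * interimAlloc A F s i z - interimPay A F s i z

/-- Bayes-Nash equilibrium. Bids are nonnegative real numbers, and the values of an agent are the
points of the support of the value distribution `F`. -/
def IsBayesNash {n : ℕ} (A : Auction n) (F : Measure ℝ) (s : Fin n → ℝ → ℝ) : Prop :=
  ∀ i, ∀ t ∈ F.support, 0 ≤ s i t ∧
    ∀ z, 0 ≤ z → interimUtility A F s i t z ≤ interimUtility A F s i t (s i t)

/-- The allocation rule in quantile space of agent `i` when all agents play the strategy `s`:
`x(q)` is the interim allocation of the bid `b(q) = s (v q)`. -/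
def quantileAlloc {n : ℕ} (A : Auction n) (F : Measure ℝ) (s v : ℝ → ℝ) (i : Fin n) (q : ℝ) : ℝ :=
  interimAlloc A F (fun _ => s) i (s (v q))

/-! ## Quantile functions, the estimator and its error -/

/-- `f` is on `[0, 1]` the continuous inverse of the distribution function of `μ`
(hence `f` is strictly increasing on `[0, 1]` and `μ` has no atoms). -/
structure IsQuantileFunction (μ : Measure ℝ) (f : ℝ → ℝ) : Prop where
  cdf_apply : ∀ q ∈ Icc (0 : ℝ) 1, cdf μ (f q) = q
  continuousOn : ContinuousOn f (Icc 0 1)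

/-- The empirical quantile estimator: with the samples sorted increasingly as
`B₀ ≤ B₁ ≤ … ≤ B_{N-1}`, its value is `B_k` on `[k / N, (k + 1) / N)`; outside `[0, 1)` it is
given the irrelevant value `0` or `B₀`. -/
def bidEstimator {N : ℕ} (sample : Fin N → ℝ) (q : ℝ) : ℝ :=
  if h : ⌊q * N⌋₊ < N then sample (Tuple.sort sample ⟨⌊q * N⌋₊, h⟩) else 0

/-- The mean squared error `E[sup_q |b(q) - b̂(q)|²]^{1/2}` of the estimator from `N` independent
samples of the bid distribution `ν`. -/
def mse (ν : Measure ℝ) (b : ℝ → ℝ) (N : ℕ) : ℝ≥0∞ :=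
  (∫⁻ sample : Fin N → ℝ,
      ⨆ q ∈ Ico (0 : ℝ) 1, ENNReal.ofReal (|b q - bidEstimator sample q| ^ 2)
    ∂(Measure.pi fun _ => ν)) ^ (1 / 2 : ℝ)

/-- The error `e` has rate of convergence `r`: `r(N) e(N) = Θ(1)` as `N → ∞`. -/
def HasConvergenceRate (r : ℕ → ℝ) (e : ℕ → ℝ≥0∞) : Prop :=
  ∃ c C : ℝ, 0 < c ∧ ∀ᶠ N in atTop,
    ENNReal.ofReal c ≤ ENNReal.ofReal (r N) * e N ∧
      ENNReal.ofReal (r N) * e N ≤ ENNReal.ofReal C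

/-- The supremum in `[0, ∞]` of a nonnegative function over the quantiles `q ∈ (0, 1)`. -/
def quantileSup (g : ℝ → ℝ) : ℝ≥0∞ :=
  ⨆ q ∈ Ioo (0 : ℝ) 1, ENNReal.ofReal (g q)

end BidInference

end

namespace BidInference

/-! ## A maximal inequality for empirical averages over a decreasing chain of sets -/

/-! The estimator is controlled by an `L²` form of the Dvoretzky–Kiefer–Wolfowitz bound: the
expected squared maximal deviation of the empirical distribution function from the true one over a
grid is `O(1/N)`, with an absolute constant. For a decreasing chain of sets `A j` of probability `p
j`, the functions `1_{A j} / p j - 1` are centred and form a martingale in `j`, and so do their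
sample averages. Doob's inequality bounds the maximum by the last term, whose second moment is at
most `1/N` once `p j ≥ 1/2`. Quantiles below `1/2` are reached by upper tails and the others by
lower tails (`exists_maximal_empAvg_indicator`, `exists_grid_deviation`).

Inverting on a grid of mesh `1/(2N)` locates each order statistic in quantile space
(`abs_sub_le_of_grid`), and the Lipschitz constant `sup b'` turns this into an error of the bid
(`mse_le`). Conversely, the binomial fluctuation of order `1/√N` at one quantile where `b` grows at
least linearly forces an error of the same order (`le_mse`).

In equilibrium, neither type `v q` nor type `v p` gains by imitating the other. These two
inequalities squeeze `x p - x q` between multiples of `b p - b q`, so `x` is differentiable where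
`b` is, with `x' = b' / v` (all-pay) or `x' / x = b' / (v - b)` (first-price). The denominators lie
in `(0, 1]`, so `b'` is at most `x'`, respectively `x' / x`. -/

/-- The running maximum of a real sequence, started at `0`. -/
def runningMax (M : ℕ → ℝ) : ℕ → ℝ
  | 0 => max (M 0) 0
  | k + 1 => max (runningMax M k) (M (k + 1))

lemma runningMax_nonneg (M : ℕ → ℝ) (k : ℕ) : 0 ≤ runningMax M k := by
  induction k with
  | zero => exact le_max_right _ _
  | succ k ih => exact ih.trans (le_max_left _ _)

lemma le_runningMax (M : ℕ → ℝ) {j k : ℕ} (h : j ≤ k) : M j ≤ runningMax M k := by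
  induction k with
  | zero => obtain rfl : j = 0 := by omega
            exact le_max_left _ _
  | succ k ih =>
    rcases Nat.lt_or_ge k j with hj | hj
    · obtain rfl : j = k + 1 := by omega
      exact le_max_right _ _
    · exact (ih hj).trans (le_max_left _ _)

lemma runningMax_le {M : ℕ → ℝ} {c : ℝ} (hc : 0 ≤ c) {k : ℕ} (h : ∀ j ≤ k, M j ≤ c) :
    runningMax M k ≤ c := by
  induction k with
  | zero => exact max_le (h 0 le_rfl) hc
  | succ k ih => exact max_le (ih fun j hj => h j (by omega)) (h _ le_rfl)

lemma runningMax_congr {M M' : ℕ → ℝ} {k : ℕ} (h : ∀ j ≤ k, M j = M' j) :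
    runningMax M k = runningMax M' k := by
  induction k with
  | zero => simp only [runningMax, h 0 le_rfl]
  | succ k ih => simp only [runningMax, ih fun j hj => h j (by omega), h (k + 1) le_rfl]

lemma measurable_runningMax {Ω : Type*} [MeasurableSpace Ω] {M : ℕ → Ω → ℝ}
    (hM : ∀ j, Measurable (M j)) (k : ℕ) : Measurable fun ω => runningMax (fun j => M j ω) k := by
  induction k with
  | zero => exact (hM 0).max measurable_const
  | succ k ih => exact ih.max (hM _)

/-- The pathwise form of Doob's `L²` maximal inequality. -/
lemma runningMax_sq_le (M : ℕ → ℝ) (n : ℕ) :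
    runningMax M n ^ 2 + 4 * ∑ k ∈ Finset.range n, runningMax M k * (M (k + 1) - M k)
      ≤ 4 * M n ^ 2 := by
  -- This stronger bound is the one that survives the induction; `4RM ≤ R² + 4M²` then gives the
  -- claim. The sum is a martingale transform, which has mean zero in the application.
  suffices h : 2 * runningMax M n ^ 2
      + 4 * ∑ k ∈ Finset.range n, runningMax M k * (M (k + 1) - M k) ≤ 4 * runningMax M n * M n by
    nlinarith [sq_nonneg (runningMax M n - 2 * M n)]
  induction n with
  | zero =>
    rcases le_total (M 0) 0 with h | h
    · simp [runningMax, h]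
    · simp only [runningMax, max_eq_left h, Finset.range_zero, Finset.sum_empty]
      nlinarith [sq_nonneg (M 0)]
  | succ n ih =>
    rw [Finset.sum_range_succ]
    rcases le_total (runningMax M n) (M (n + 1)) with h | h
    · simp only [runningMax, max_eq_right h]
      nlinarith [sq_nonneg (M (n + 1) - runningMax M n)]
    · simp only [runningMax, max_eq_left h]
      nlinarith

section MaximalInequality

variable {S : Type*}

/-- The average of a function over a sample. -/
noncomputable def empAvg {N : ℕ} (f : S → ℝ) (ω : Fin N → S) : ℝ := (∑ i, f (ω i)) / N

lemma abs_empAvg_le {N : ℕ} {f : S → ℝ} {B : ℝ} (hB : 0 ≤ B) (hf : ∀ x, |f x| ≤ B)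
    (ω : Fin N → S) : |empAvg f ω| ≤ B := by
  rcases N.eq_zero_or_pos with rfl | hN
  · simpa [empAvg] using hB
  have hN' : (0 : ℝ) < N := by exact_mod_cast hN
  rw [empAvg, abs_div, abs_of_pos hN', div_le_iff₀ hN']
  calc |∑ i, f (ω i)| ≤ ∑ i, |f (ω i)| := Finset.abs_sum_le_sum_abs _ _
    _ ≤ ∑ _i : Fin N, B := Finset.sum_le_sum fun i _ => hf _
    _ = B * N := by simp [mul_comm]

variable [MeasurableSpace S]

lemma measurable_empAvg {N : ℕ} {f : S → ℝ} (hf : Measurable f) :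
    Measurable (empAvg f : (Fin N → S) → ℝ) := by
  unfold empAvg
  fun_prop

variable (ν : Measure S) [IsProbabilityMeasure ν]

/-- The coordinates are independent, so variances add. -/
lemma integral_sq_empAvg {N : ℕ} (hN : 0 < N) {f : S → ℝ} (hf : MemLp f 2 ν)
    (h0 : ∫ x, f x ∂ν = 0) :
    ∫ ω : Fin N → S, empAvg f ω ^ 2 ∂(Measure.pi fun _ => ν) = (∫ x, f x ^ 2 ∂ν) / N := by
  have hN' : (N : ℝ) ≠ 0 := by exact_mod_cast hN.ne'
  have hv := variance_sum_pi (μ := fun _ : Fin N => ν) (X := fun _ => f) fun _ => hf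
  have hcomp : ∀ i : Fin N, MemLp (fun ω : Fin N → S => f (ω i)) 2 (Measure.pi fun _ => ν) :=
    fun i => hf.comp_measurePreserving (measurePreserving_eval (fun _ : Fin N => ν) i)
  have hmem : MemLp (∑ i, fun ω : Fin N → S => f (ω i)) 2 (Measure.pi fun _ => ν) :=
    memLp_finsetSum' _ fun i _ => hcomp i
  rw [variance_of_integral_eq_zero hmem.aemeasurable] at hv
  · simp only [variance_of_integral_eq_zero hf.aemeasurable h0, Finset.sum_const,
      Finset.card_univ, Fintype.card_fin, nsmul_eq_mul, Finset.sum_apply] at hv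
    simp only [empAvg, div_pow, integral_div, hv]
    field_simp
  · simp only [Finset.sum_apply]
    rw [integral_finsetSum _ fun i _ => (hcomp i).integrable (by norm_num)]
    refine Finset.sum_eq_zero fun i _ => ?_
    rw [integral_comp_eval (μ := fun _ : Fin N => ν) (f := f) hf.aestronglyMeasurable, h0]

/-- If `d` is centred and vanishes off `B`, and `g` does not depend on the `i`-th coordinate as
long as this stays in `B`, then `g` and `d` are orthogonal. -/
lemma integral_mul_comp_eval_eq_zero {N : ℕ} (i : Fin N) {g : (Fin N → S) → ℝ} {d : S → ℝ}
    {B : Set S} (hB : B.Nonempty)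
    (hg : ∀ ω, ω i ∈ B → ∀ a ∈ B, g (Function.update ω i a) = g ω)
    (hd : ∀ x ∉ B, d x = 0) (h0 : ∫ x, d x ∂ν = 0) :
    ∫ ω, g ω * d (ω i) ∂(Measure.pi fun _ => ν) = 0 := by
  obtain ⟨a, ha⟩ := hB
  obtain ⟨N, rfl⟩ : ∃ m, N = m + 1 := ⟨N - 1, by have := i.pos; omega⟩
  -- Freezing coordinate `i` at `a ∈ B` inside `g` does not change the product `g ω * d (ω i)`: off
  -- `B` the factor `d` vanishes. The frozen `g` and `d` then depend on complementary coordinates,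
  -- so Fubini factors the integral.
  have key := (measurePreserving_piFinSuccAbove (fun _ : Fin (N + 1) => ν) i).integral_comp'
    (fun z : S × (Fin N → S) => d z.1 * g (i.insertNth (α := fun _ => S) a z.2))
  rw [integral_prod_mul (fun x => d x)
    (fun y : Fin N → S => g (i.insertNth (α := fun _ => S) a y)), h0, zero_mul] at key
  rw [← key]
  refine integral_congr_ae (ae_of_all _ fun ω => ?_)
  have hupd : i.insertNth (α := fun _ => S) a (i.removeNth ω) = Function.update ω i a :=
    Fin.insertNth_removeNth _ _ _
  change g ω * d (ω i) = d (ω i) * g (i.insertNth (α := fun _ => S) a (i.removeNth ω))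
  rw [hupd]
  by_cases hi : ω i ∈ B
  · rw [hg ω hi a ha, mul_comm]
  · rw [hd _ hi, zero_mul, mul_zero]

/-- Doob's `L²` maximal inequality for the averages of a sequence of functions which behaves like
a martingale stopped on leaving a set of a decreasing chain. -/
lemma integral_runningMax_empAvg_sq_le {N : ℕ} {h : ℕ → S → ℝ} {A : ℕ → Set S} {b : ℝ}
    (hm : ∀ j, Measurable (h j)) (hb0 : 0 ≤ b) (hb : ∀ j x, |h j x| ≤ b) (m : ℕ)
    (hA : ∀ k < m, (A k).Nonempty)
    (hout : ∀ k < m, ∀ x ∉ A k, h (k + 1) x = h k x)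
    (hin : ∀ k < m, ∀ j ≤ k, ∀ x ∈ A k, ∀ y ∈ A k, h j x = h j y)
    (h0 : ∀ k ≤ m, ∫ x, h k x ∂ν = 0) :
    ∫ ω : Fin N → S, runningMax (fun j => empAvg (h j) ω) m ^ 2 ∂(Measure.pi fun _ => ν)
      ≤ 4 * ∫ ω : Fin N → S, empAvg (h m) ω ^ 2 ∂(Measure.pi fun _ => ν) := by
  set P : Measure (Fin N → S) := Measure.pi fun _ => ν with hP
  have hbdd : ∀ {f : (Fin N → S) → ℝ} (C : ℝ), Measurable f → (∀ ω, |f ω| ≤ C) →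
      Integrable f P := fun C hf hC =>
    Integrable.of_bound hf.aestronglyMeasurable C (ae_of_all _ hC)
  have hW : ∀ j, Measurable fun ω : Fin N → S => empAvg (h j) ω := fun j => measurable_empAvg (hm j)
  have hR := fun k => measurable_runningMax hW k
  have hWb : ∀ j (ω : Fin N → S), |empAvg (h j) ω| ≤ b := fun j ω => abs_empAvg_le hb0 (hb j) ω
  have hRb : ∀ k (ω : Fin N → S), |runningMax (fun j => empAvg (h j) ω) k| ≤ b := fun k ω => by
    rw [abs_of_nonneg (runningMax_nonneg _ _)]
    exact runningMax_le hb0 fun j _ => (le_abs_self _).trans (hWb j ω)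
  have hint : ∀ k, Integrable (h k) ν := fun k =>
    Integrable.of_bound (hm k).aestronglyMeasurable b (ae_of_all _ (hb k))
  -- Replaces conditional expectations. The increment `h (k + 1) - h k` lives on `A k`, where every
  -- earlier `h j` is constant, so the running maximum does not see where in `A k` the `i`-th sample
  -- lies.
  have horth : ∀ k < m, ∀ i : Fin N, ∫ ω, runningMax (fun j => empAvg (h j) ω) k *
      (h (k + 1) (ω i) - h k (ω i)) ∂P = 0 := by
    intro k hk i
    refine integral_mul_comp_eval_eq_zero ν i (d := fun x => h (k + 1) x - h k x) (hA k hk)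
      (fun ω hω a ha => ?_) (fun x hx => sub_eq_zero.2 (hout k hk x hx)) ?_
    · refine runningMax_congr fun j hj => ?_
      simp only [empAvg]
      congr 1
      refine Finset.sum_congr rfl fun l _ => ?_
      rcases eq_or_ne l i with rfl | hl
      · rw [Function.update_self]
        exact hin k hk j hj _ ha _ hω
      · rw [Function.update_of_ne hl]
    · rw [integral_sub (hint _) (hint _), h0 _ hk, h0 _ hk.le, sub_zero]
  have hstep : ∀ k < m, ∫ ω, runningMax (fun j => empAvg (h j) ω) k *
      (empAvg (h (k + 1)) ω - empAvg (h k) ω) ∂P = 0 := by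
    intro k hk
    have : ∀ ω : Fin N → S, runningMax (fun j => empAvg (h j) ω) k *
        (empAvg (h (k + 1)) ω - empAvg (h k) ω) = (∑ i, runningMax (fun j => empAvg (h j) ω) k *
          (h (k + 1) (ω i) - h k (ω i))) / N := by
      intro ω
      rw [← Finset.mul_sum, Finset.sum_sub_distrib]
      simp only [empAvg]
      ring
    simp only [this]
    rw [integral_div, integral_finsetSum, Finset.sum_eq_zero fun i _ => horth k hk i, zero_div]
    intro i _
    refine hbdd (b * (b + b)) ?_ fun ω => ?_
    · exact (hR k).mul (((hm _).comp (measurable_pi_apply i)).sub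
        ((hm _).comp (measurable_pi_apply i)))
    · rw [abs_mul]
      exact mul_le_mul (hRb k ω) ((abs_sub _ _).trans (add_le_add (hb _ _) (hb _ _)))
        (abs_nonneg _) hb0
  have hsq : ∀ {f : (Fin N → S) → ℝ}, Measurable f → (∀ ω, |f ω| ≤ b) →
      Integrable (fun ω => f ω ^ 2) P := fun hf hC =>
    hbdd (b ^ 2) (hf.pow_const 2) fun ω => by
      rw [abs_pow]
      exact pow_le_pow_left₀ (abs_nonneg _) (hC ω) 2
  have hsi : ∀ k, Integrable (fun ω => runningMax (fun j => empAvg (h j) ω) k *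
      (empAvg (h (k + 1)) ω - empAvg (h k) ω)) P := fun k => by
    refine hbdd (b * (b + b)) ((hR k).mul ((hW _).sub (hW _))) fun ω => ?_
    rw [abs_mul]
    exact mul_le_mul (hRb k ω) ((abs_sub _ _).trans (add_le_add (hWb _ _) (hWb _ _)))
      (abs_nonneg _) hb0
  have hmono := integral_mono (μ := P)
    ((hsq (hR m) (hRb m)).add ((integrable_finsetSum (Finset.range m) fun k _ => hsi k).const_mul 4))
    ((hsq (hW m) (hWb m)).const_mul 4)
    (fun ω => runningMax_sq_le (fun j => empAvg (h j) ω) m)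
  simp only [Pi.add_apply] at hmono
  rw [integral_add (hsq (hR m) (hRb m))
    ((integrable_finsetSum (Finset.range m) fun k _ => hsi k).const_mul 4),
    integral_const_mul, integral_const_mul, integral_finsetSum _ fun k _ => hsi k,
    Finset.sum_eq_zero fun k hk => hstep k (Finset.mem_range.1 hk), mul_zero, add_zero] at hmono
  exact hmono

/-- For a decreasing chain of sets of probability at least `1 / 2`, the largest deviation of an
empirical frequency is of order `1 / √N` in `L²`. -/
lemma exists_maximal_empAvg_indicator {N : ℕ} (hN : 0 < N) {A : ℕ → Set S} (hA : Antitone A)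
    (hAm : ∀ j, MeasurableSet (A j)) {m : ℕ} (hp : ∀ j ≤ m, 1 / 2 ≤ ν.real (A j)) :
    ∃ D : (Fin N → S) → ℝ, Integrable D (Measure.pi fun _ => ν) ∧
      ∫ ω, D ω ∂(Measure.pi fun _ => ν) ≤ 8 / N ∧ (∀ ω, 0 ≤ D ω) ∧
      ∀ ω, ∀ j ≤ m, (empAvg ((A j).indicator 1) ω - ν.real (A j)) ^ 2 ≤ D ω := by
  have hN' : (0 : ℝ) < N := by exact_mod_cast hN
  -- Stopping the index at `m` makes `p j ≥ 1 / 2`, hence `|h j| ≤ 1`, valid for every `j`.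
  set p : ℕ → ℝ := fun j => ν.real (A (min j m)) with hpdef
  have hp2 : ∀ j, 1 / 2 ≤ p j := fun j => hp _ (min_le_right _ _)
  have hp1 : ∀ j, p j ≤ 1 := fun j => measureReal_le_one
  set h : ℕ → S → ℝ := fun j x => (A (min j m)).indicator 1 x / p j - 1 with hh
  have hind : ∀ j x, (A j).indicator (1 : S → ℝ) x = 0 ∨ (A j).indicator (1 : S → ℝ) x = 1 :=
    fun j x => by by_cases hx : x ∈ A j <;> simp [hx]
  have hm : ∀ j, Measurable (h j) := fun j =>
    ((measurable_one.indicator (hAm _)).div_const _).sub_const _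
  have hb : ∀ j x, |h j x| ≤ 1 := by
    intro j x
    have h2 : 1 / p j ≤ 2 := by
      rw [div_le_iff₀ (by linarith [hp2 j])]; linarith [hp2 j]
    have h1 : 0 ≤ 1 / p j := by have := hp2 j; positivity
    rcases hind (min j m) x with hx | hx
    · simp [hh, hx]
    · simp only [hh, hx, abs_le]
      constructor <;> linarith
  have h0 : ∀ j, ∫ x, h j x ∂ν = 0 := by
    intro j
    have hi : Integrable ((A (min j m)).indicator (1 : S → ℝ)) ν :=
      (integrable_const (1 : ℝ)).indicator (hAm _)
    simp only [hh]
    rw [integral_sub (hi.div_const _) (integrable_const _), integral_div,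
      integral_indicator_one (hAm _)]
    simp only [integral_const, probReal_univ, smul_eq_mul, mul_one]
    exact sub_eq_zero.2 (div_self (by have := hp2 j; simp only [hpdef] at this ⊢; linarith))
  have hne : ∀ k < m, (A k).Nonempty := by
    intro k hk
    by_contra hcon
    have := hp k hk.le
    rw [not_nonempty_iff_eq_empty.1 hcon, measureReal_empty] at this
    norm_num at this
  have hin : ∀ k < m, ∀ j ≤ k, ∀ x ∈ A k, ∀ y ∈ A k, h j x = h j y := by
    intro k hk j hj x hx y hy
    have : min j m = j := by omega
    simp only [hh, this, indicator_of_mem (hA hj hx), indicator_of_mem (hA hj hy)]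
    rfl
  have hout : ∀ k < m, ∀ x ∉ A k, h (k + 1) x = h k x := by
    intro k hk x hx
    have e1 : min (k + 1) m = k + 1 := by omega
    have e2 : min k m = k := by omega
    have hx' : x ∉ A (k + 1) := fun hc => hx (hA k.le_succ hc)
    simp [hh, e1, e2, hx, hx']
  have hsq : ∫ ω : Fin N → S, empAvg (h m) ω ^ 2 ∂(Measure.pi fun _ => ν) ≤ 1 / N := by
    rw [integral_sq_empAvg ν hN (MemLp.of_bound (hm m).aestronglyMeasurable 1 (ae_of_all _ (hb m)))
      (h0 m)]
    gcongr
    calc ∫ x, h m x ^ 2 ∂ν ≤ ∫ _x, (1 : ℝ) ∂ν := by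
          refine integral_mono_of_nonneg (ae_of_all _ fun x => sq_nonneg _) (integrable_const _)
            (ae_of_all _ fun x => ?_)
          exact (sq_le_one_iff_abs_le_one _).2 (hb m x)
      _ = 1 := by simp
  have hneg : ∀ j (ω : Fin N → S), empAvg (fun x => -h j x) ω = -empAvg (h j) ω := fun j ω => by
    simp only [empAvg, Finset.sum_neg_distrib, neg_div]
  have hpos := integral_runningMax_empAvg_sq_le (N := N) ν hm zero_le_one hb m hne hout hin
    fun k _ => h0 k
  have hminus := integral_runningMax_empAvg_sq_le (N := N) ν (h := fun j x => -h j x)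
    (fun j => (hm j).neg) zero_le_one (fun j x => by rw [abs_neg]; exact hb j x) m hne
    (fun k hk x hx => by rw [hout k hk x hx])
    (fun k hk j hj x hx y hy => by rw [hin k hk j hj x hx y hy])
    fun k _ => by rw [integral_neg, h0 k, neg_zero]
  simp only [hneg, neg_sq] at hminus
  have hint : ∀ M : ℕ → (Fin N → S) → ℝ, (∀ j, Measurable (M j)) → (∀ j ω, |M j ω| ≤ 1) →
      Integrable (fun ω => runningMax (fun j => M j ω) m ^ 2) (Measure.pi fun _ => ν) := by
    intro M hM hMb
    refine Integrable.of_bound ((measurable_runningMax hM m).pow_const 2).aestronglyMeasurable 1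
      (ae_of_all _ fun ω => ?_)
    rw [Real.norm_of_nonneg (sq_nonneg _), sq_le_one_iff₀ (runningMax_nonneg _ _)]
    exact runningMax_le zero_le_one fun j _ => (le_abs_self _).trans (hMb j ω)
  have hi1 := hint (fun j ω => empAvg (h j) ω) (fun j => measurable_empAvg (hm j))
    fun j ω => abs_empAvg_le zero_le_one (hb j) ω
  have hi2 := hint (fun j ω => -empAvg (h j) ω) (fun j => (measurable_empAvg (hm j)).neg)
    fun j ω => by rw [abs_neg]; exact abs_empAvg_le zero_le_one (hb j) ω
  -- The running maximum is one-sided, so the maxima for `h` and `-h` are added; each contributes `4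
  -- / N`.
  refine ⟨fun ω => runningMax (fun j => empAvg (h j) ω) m ^ 2
    + runningMax (fun j => -empAvg (h j) ω) m ^ 2, hi1.add hi2, ?_, fun ω => by positivity, ?_⟩
  · rw [integral_add hi1 hi2]
    have : (8 : ℝ) / N = 4 * (1 / N) + 4 * (1 / N) := by ring
    rw [this]
    exact add_le_add (hpos.trans (by gcongr)) (hminus.trans (by gcongr))
  · intro ω j hj
    have e : empAvg ((A j).indicator 1) ω - ν.real (A j) = p j * empAvg (h j) ω := by
      have hpj : p j ≠ 0 := by have := hp2 j; linarith
      have ejm : min j m = j := by omega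
      have : ν.real (A j) = p j := by simp only [hpdef, ejm]
      rw [this]
      simp only [empAvg, hh, ejm, Finset.sum_sub_distrib, ← Finset.sum_div, Finset.sum_const,
        Finset.card_univ, Fintype.card_fin, nsmul_eq_mul, mul_one]
      field_simp
    have hle : empAvg (h j) ω ^ 2 ≤ runningMax (fun j => empAvg (h j) ω) m ^ 2
        + runningMax (fun j => -empAvg (h j) ω) m ^ 2 := by
      have g1 := le_runningMax (fun j => empAvg (h j) ω) hj
      have g2 := le_runningMax (fun j => -empAvg (h j) ω) hj
      rcases le_total 0 (empAvg (h j) ω) with hs | hs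
      · have := pow_le_pow_left₀ hs g1 2
        nlinarith [sq_nonneg (runningMax (fun j => -empAvg (h j) ω) m)]
      · have := pow_le_pow_left₀ (by simpa using hs) g2 2
        nlinarith [sq_nonneg (runningMax (fun j => empAvg (h j) ω) m)]
    rw [e, mul_pow]
    refine le_trans ?_ hle
    have : p j ^ 2 ≤ 1 := pow_le_one₀ (by linarith [hp2 j]) (hp1 j)
    nlinarith [sq_nonneg (empAvg (h j) ω)]

end MaximalInequality

/-! ## Quantile functions -/

lemma IsQuantileFunction.strictMonoOn {μ : Measure ℝ} {f : ℝ → ℝ} (hf : IsQuantileFunction μ f) :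
    StrictMonoOn f (Icc 0 1) := by
  intro p hp q hq hpq
  by_contra hcon
  have := monotone_cdf μ (not_lt.1 hcon)
  rw [hf.cdf_apply p hp, hf.cdf_apply q hq] at this
  exact absurd hpq (not_lt.2 this)

lemma IsQuantileFunction.measureReal_Iic {μ : Measure ℝ} [IsProbabilityMeasure μ] {f : ℝ → ℝ}
    (hf : IsQuantileFunction μ f) {q : ℝ} (hq : q ∈ Icc (0 : ℝ) 1) : μ.real (Iic (f q)) = q := by
  rw [← cdf_eq_real, hf.cdf_apply q hq]

lemma IsQuantileFunction.measureReal_Ioi {μ : Measure ℝ} [IsProbabilityMeasure μ] {f : ℝ → ℝ}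
    (hf : IsQuantileFunction μ f) {q : ℝ} (hq : q ∈ Icc (0 : ℝ) 1) :
    μ.real (Ioi (f q)) = 1 - q := by
  rw [← compl_Iic, probReal_compl_eq_one_sub measurableSet_Iic, hf.measureReal_Iic hq]

/-- There is no mass up to `f 0` or beyond `f 1`, and by continuity `f` reaches everything in
between. -/
lemma IsQuantileFunction.ae_mem_image {μ : Measure ℝ} [IsProbabilityMeasure μ] {f : ℝ → ℝ}
    (hf : IsQuantileFunction μ f) : ∀ᵐ x ∂μ, x ∈ f '' Icc 0 1 := by
  have h0 : ∀ᵐ x ∂μ, x ∉ Iic (f 0) := by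
    rw [← measure_eq_zero_iff_ae_notMem, ← measureReal_eq_zero_iff]
    exact hf.measureReal_Iic (by simp)
  have h1 : ∀ᵐ x ∂μ, x ∉ Ioi (f 1) := by
    rw [← measure_eq_zero_iff_ae_notMem, ← measureReal_eq_zero_iff, hf.measureReal_Ioi (by simp)]
    norm_num
  filter_upwards [h0, h1] with x hx0 hx1
  simp only [mem_Iic, not_le, mem_Ioi, not_lt] at hx0 hx1
  exact intermediate_value_Icc zero_le_one hf.continuousOn ⟨hx0.le, hx1⟩

/-! ## The empirical quantile estimator -/

section Count

variable {N : ℕ} (ω : Fin N → ℝ)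

lemma empAvg_indicator_Iic (y : ℝ) :
    empAvg ((Iic y).indicator 1) ω = ((Finset.univ.filter fun i => ω i ≤ y).card : ℝ) / N := by
  simp [empAvg, indicator_apply, Finset.sum_boole]

/-- With `card_filter_lt_sort_le`, this translates between order statistics and counts. One bound
uses `≤` and the other `<`, so ties in the sample do no harm. -/
lemma succ_le_card_filter_le_sort (k : Fin N) :
    (k : ℕ) + 1 ≤ (Finset.univ.filter fun i => ω i ≤ ω (Tuple.sort ω k)).card := by
  calc (k : ℕ) + 1 = ((Finset.Iic k).map (Tuple.sort ω).toEmbedding).card := by simp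
    _ ≤ _ := Finset.card_le_card fun i hi => by
      obtain ⟨j, hj, rfl⟩ := Finset.mem_map.1 hi
      exact Finset.mem_filter.2 ⟨Finset.mem_univ _, Tuple.monotone_sort ω (Finset.mem_Iic.1 hj)⟩

lemma card_filter_lt_sort_le (k : Fin N) :
    (Finset.univ.filter fun i => ω i < ω (Tuple.sort ω k)).card ≤ k := by
  calc _ ≤ ((Finset.Iio k).map (Tuple.sort ω).toEmbedding).card :=
        Finset.card_le_card fun i hi => by
          refine Finset.mem_map.2 ⟨(Tuple.sort ω).symm i, Finset.mem_Iio.2 ?_, by simp⟩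
          by_contra hcon
          have := Tuple.monotone_sort ω (not_lt.1 hcon)
          simp only [Function.comp_apply, Equiv.apply_symm_apply] at this
          exact absurd (Finset.mem_filter.1 hi).2 (not_lt.2 this)
    _ = k := by simp

lemma bidEstimator_eq {q : ℝ} {k : ℕ} (hk : k < N) (h1 : (k : ℝ) ≤ q * N) (h2 : q * N < k + 1) :
    bidEstimator ω q = ω (Tuple.sort ω ⟨k, hk⟩) := by
  have : ⌊q * N⌋₊ = k := by
    rw [Nat.floor_eq_iff ((Nat.cast_nonneg _).trans h1)]
    exact ⟨h1, h2⟩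
  subst this
  simp [bidEstimator, hk]

/-- If the empirical distribution function is within `D` of the true one on a grid of mesh
`1 / M`, then the order statistics are within `D + 1 / M` of the true quantiles. -/
lemma abs_sub_le_of_grid {b : ℝ → ℝ} (hb : StrictMonoOn b (Icc 0 1)) {M : ℕ} (hM : 0 < M) {D : ℝ}
    (hD : ∀ j ≤ M, |empAvg ((Iic (b (j / M))).indicator 1) ω - j / M| ≤ D) (k : Fin N) {u q : ℝ}
    (hu : u ∈ Icc (0 : ℝ) 1) (hbu : b u = ω (Tuple.sort ω k)) (hq0 : 0 ≤ q)
    (hq1 : (k : ℝ) ≤ q * N) (hq2 : q * N ≤ k + 1) : |q - u| ≤ D + 1 / M := by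
  have hN : (0 : ℝ) < N := by exact_mod_cast k.pos
  have hM' : (0 : ℝ) < M := by exact_mod_cast hM
  have hgrid : ∀ j ≤ M, (j : ℝ) / M ∈ Icc (0 : ℝ) 1 := fun j hj =>
    ⟨by positivity, (div_le_one hM').2 (by exact_mod_cast hj)⟩
  have hD0 : 0 ≤ D := (abs_nonneg _).trans (hD 0 (Nat.zero_le _))
  rw [abs_le]
  constructor
  · rcases hu.1.eq_or_lt with h0 | h0
    · rw [← h0]
      have : 0 ≤ 1 / (M : ℝ) := by positivity
      linarith
    -- `j / M` is the last grid point strictly below `u`; strictness leaves at most `k` samples up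
    -- to `b (j / M)`. No such point exists when `u = 0`.
    obtain ⟨j, hj⟩ : ∃ j, ⌈u * M⌉₊ = j + 1 :=
      ⟨⌈u * M⌉₊ - 1, by have := Nat.ceil_pos.2 (mul_pos h0 hM'); omega⟩
    have hlt : (j : ℝ) < u * M := Nat.lt_ceil.1 (by omega)
    have hge : u * M ≤ j + 1 := by
      have := Nat.le_ceil (u * M)
      rw [hj] at this
      exact_mod_cast this
    have hjM : j ≤ M := by
      have : (j : ℝ) < M := hlt.trans_le (mul_le_of_le_one_left hM'.le hu.2)
      exact_mod_cast this.le
    have hju : (j : ℝ) / M < u := (div_lt_iff₀ hM').2 hlt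
    have hcard : ((Finset.univ.filter fun i => ω i ≤ b (j / M)).card : ℝ) ≤ k := by
      refine Nat.cast_le.2 ((Finset.card_le_card fun i hi => ?_).trans
        (card_filter_lt_sort_le ω k))
      rw [Finset.mem_filter] at hi ⊢
      exact ⟨hi.1, hi.2.trans_lt ((hb (hgrid j hjM) hu hju).trans_eq hbu)⟩
    have h1 := (abs_le.1 (hD j hjM)).1
    rw [empAvg_indicator_Iic] at h1
    have h2 : ((Finset.univ.filter fun i => ω i ≤ b (j / M)).card : ℝ) / N ≤ q :=
      (div_le_iff₀ hN).2 (hcard.trans hq1)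
    have h3 : u ≤ j / M + 1 / M := by
      rw [← add_div, le_div_iff₀ hM']
      exact hge
    linarith
  · set j := ⌈u * M⌉₊
    have hge : u * M ≤ j := Nat.le_ceil _
    have hlt : (j : ℝ) < u * M + 1 := Nat.ceil_lt_add_one (mul_nonneg hu.1 hM'.le)
    have hjM : j ≤ M := Nat.ceil_le.2 (mul_le_of_le_one_left hM'.le hu.2)
    have hju : u ≤ (j : ℝ) / M := (le_div_iff₀ hM').2 hge
    have hcard : (k : ℝ) + 1 ≤ ((Finset.univ.filter fun i => ω i ≤ b (j / M)).card : ℝ) := by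
      have := (succ_le_card_filter_le_sort ω k).trans (Finset.card_le_card
        (t := Finset.univ.filter fun i => ω i ≤ b (j / M)) fun i hi => by
          rw [Finset.mem_filter] at hi ⊢
          exact ⟨hi.1, hi.2.trans (hbu.symm.le.trans (hb.monotoneOn hu (hgrid j hjM) hju))⟩)
      exact_mod_cast this
    have h1 := (abs_le.1 (hD j hjM)).2
    rw [empAvg_indicator_Iic] at h1
    have h2 : q ≤ ((Finset.univ.filter fun i => ω i ≤ b (j / M)).card : ℝ) / N :=
      (le_div_iff₀ hN).2 (hq2.trans hcard)
    have h3 : (j : ℝ) / M ≤ u + 1 / M := by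
      rw [div_le_iff₀ hM', add_mul, one_div, inv_mul_cancel₀ hM'.ne']
      exact hlt.le
    linarith

/-- A deviation of the empirical distribution function at `b q₀` forces the estimator to err. -/
lemma exists_le_abs_sub_bidEstimator (hN : 0 < N) {b : ℝ → ℝ} {κ q₀ : ℝ} (hκ : 0 < κ)
    (hq₀ : q₀ ∈ Ioo (0 : ℝ) 1)
    (hlow : ∀ q ∈ Icc (0 : ℝ) q₀, κ * (q₀ - q) ≤ b q₀ - b q)
    (hup : ∀ q ∈ Icc q₀ 1, κ * (q - q₀) ≤ b q - b q₀) :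
    ∃ q ∈ Ico (0 : ℝ) 1, κ * (|empAvg ((Iic (b q₀)).indicator 1) ω - q₀| / 2)
      ≤ |b q - bidEstimator ω q| := by
  have hN' : (0 : ℝ) < N := by exact_mod_cast hN
  rw [empAvg_indicator_Iic]
  set c := (Finset.univ.filter fun i => ω i ≤ b q₀).card with hc
  have hcN : c ≤ N := (Finset.card_le_univ _).trans_eq (by simp)
  have hc1 : (c : ℝ) / N ≤ 1 := (div_le_one hN').2 (by exact_mod_cast hcN)
  rcases lt_trichotomy ((c : ℝ) / N) q₀ with h | h | h
  · have hcN' : c < N := by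
      have : (c : ℝ) / N < 1 := h.trans hq₀.2
      rw [div_lt_one hN'] at this
      exact_mod_cast this
    -- Only `c` samples lie at or below `b q₀`, so the estimator at `c / N` is a sample above `b
    -- q₀`, although `c / N < q₀`.
    refine ⟨(c : ℝ) / N, ⟨by positivity, h.trans hq₀.2⟩, ?_⟩
    have hmul : (c : ℝ) / N * N = c := div_mul_cancel₀ _ hN'.ne'
    rw [bidEstimator_eq ω hcN' hmul.ge (by rw [hmul]; linarith)]
    have hgt : b q₀ < ω (Tuple.sort ω ⟨c, hcN'⟩) := by
      by_contra hcon
      have := (succ_le_card_filter_le_sort ω ⟨c, hcN'⟩).trans (Finset.card_le_card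
        (t := Finset.univ.filter fun i => ω i ≤ b q₀) fun i hi => by
          rw [Finset.mem_filter] at hi ⊢
          exact ⟨hi.1, hi.2.trans (not_lt.1 hcon)⟩)
      rw [← hc] at this
      simp at this
    have h1 := hlow _ ⟨by positivity, h.le⟩
    rw [abs_of_neg (sub_neg.2 h), abs_sub_comm]
    refine le_trans ?_ (le_abs_self _)
    have : 0 ≤ κ * (q₀ - c / N) := mul_nonneg hκ.le (by linarith)
    linarith
  · exact ⟨0, by simp, by rw [h]; simp⟩
  · have hc0 : 0 < c := by
      by_contra hcon
      obtain h0 : c = 0 := by omega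
      rw [h0] at h
      simp at h
      linarith [hq₀.1]
    obtain ⟨k, hk⟩ : ∃ k, c = k + 1 := ⟨c - 1, by omega⟩
    have hkN : k < N := by omega
    have hck : (c : ℝ) = k + 1 := by exact_mod_cast hk
    -- The order statistic number `k = c - 1` is used on `[k / N, c / N)`, which excludes `c / N`.
    -- The midpoint of `r` and `c / N` stays in this cell and keeps half of the distance from `q₀`;
    -- this is the source of the factor `1 / 2`.
    set r := max q₀ ((k : ℝ) / N) with hr
    have hrlt : r < (c : ℝ) / N := max_lt h (by rw [hck]; gcongr; linarith)
    have hr0 : q₀ ≤ r := le_max_left _ _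
    have hrk : (k : ℝ) / N ≤ r := le_max_right _ _
    rw [div_le_iff₀ hN'] at hrk
    have hrlt' := (lt_div_iff₀ hN').1 hrlt
    have hmul : (r + c / N) / 2 * N = (r * N + c) / 2 := by field_simp
    refine ⟨(r + c / N) / 2, ⟨by linarith [hq₀.1], by linarith⟩, ?_⟩
    rw [bidEstimator_eq ω hkN (by rw [hmul]; linarith) (by rw [hmul]; linarith)]
    have hle : ω (Tuple.sort ω ⟨k, hkN⟩) ≤ b q₀ := by
      by_contra hcon
      have := (Finset.card_le_card
        (s := Finset.univ.filter fun i => ω i ≤ b q₀)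
        (t := Finset.univ.filter fun i => ω i < ω (Tuple.sort ω ⟨k, hkN⟩)) fun i hi => by
          rw [Finset.mem_filter] at hi ⊢
          exact ⟨hi.1, hi.2.trans_lt (not_le.1 hcon)⟩).trans (card_filter_lt_sort_le ω ⟨k, hkN⟩)
      rw [← hc] at this
      simp at this
      omega
    have h1 := hup ((r + c / N) / 2) ⟨by linarith, by linarith⟩
    rw [abs_of_pos (sub_pos.2 h)]
    refine le_trans ?_ (le_abs_self _)
    have : κ * ((c / N - q₀) / 2) ≤ κ * ((r + c / N) / 2 - q₀) :=
      mul_le_mul_of_nonneg_left (by linarith) hκ.le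
    linarith

end Count

/-! ## The error of the estimator -/

section Error

variable {ν : Measure ℝ} [IsProbabilityMeasure ν] {b : ℝ → ℝ}

lemma ae_forall_mem_image (hb : IsQuantileFunction ν b) (N : ℕ) :
    ∀ᵐ ω ∂(Measure.pi fun _ : Fin N => ν), ∀ i, ω i ∈ b '' Icc 0 1 :=
  ae_all_iff.2 fun i =>
    (measurePreserving_eval (fun _ : Fin N => ν) i).quasiMeasurePreserving.ae hb.ae_mem_image

/-- For `t ≤ 1 / 2` both `Ioi (b t)` and `Iic (b (1 - t))` have probability at least `1 / 2` and
shrink as `t` grows. The maximal inequality applies to each chain, one for each half of the grid,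
and the two bounds `8 / N` add up. -/
lemma exists_grid_deviation (hb : IsQuantileFunction ν b) {N : ℕ} (hN : 0 < N) :
    ∃ D : (Fin N → ℝ) → ℝ, Integrable D (Measure.pi fun _ => ν) ∧
      ∫ ω, D ω ∂(Measure.pi fun _ => ν) ≤ 16 / N ∧ (∀ ω, 0 ≤ D ω) ∧
      ∀ ω, ∀ j ≤ 2 * N, |empAvg ((Iic (b (j / (2 * N : ℕ)))).indicator 1) ω - j / (2 * N : ℕ)|
        ≤ √(D ω) := by
  have hN' : (0 : ℝ) < N := by exact_mod_cast hN
  set t : ℕ → ℝ := fun j => ((min j N : ℕ) : ℝ) / (2 * N : ℕ) with ht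
  have ht0 : ∀ j, 0 ≤ t j := fun j => by positivity
  have ht1 : ∀ j, t j ≤ 1 / 2 := fun j => by
    have : ((min j N : ℕ) : ℝ) ≤ N := by exact_mod_cast min_le_right j N
    simp only [ht]
    push_cast at this ⊢
    rw [div_le_div_iff₀ (by positivity) (by norm_num)]
    linarith
  have htI : ∀ j, t j ∈ Icc (0 : ℝ) 1 := fun j => ⟨ht0 j, (ht1 j).trans (by norm_num)⟩
  have htI' : ∀ j, 1 - t j ∈ Icc (0 : ℝ) 1 := fun j =>
    ⟨by linarith [ht1 j], by linarith [ht0 j]⟩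
  have htm : Monotone t := fun i j hij => by
    simp only [ht]
    gcongr
  have hmono := hb.strictMonoOn.monotoneOn
  obtain ⟨D₁, hi₁, hE₁, h0₁, hD₁⟩ := exists_maximal_empAvg_indicator ν hN
    (A := fun j => Ioi (b (t j))) (fun i j hij => Ioi_subset_Ioi (hmono (htI i) (htI j) (htm hij)))
    (fun _ => measurableSet_Ioi) (m := N)
    fun j _ => by rw [hb.measureReal_Ioi (htI j)]; linarith [ht1 j]
  obtain ⟨D₂, hi₂, hE₂, h0₂, hD₂⟩ := exists_maximal_empAvg_indicator ν hN
    (A := fun j => Iic (b (1 - t j)))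
    (fun i j hij => Iic_subset_Iic.2 (hmono (htI' j) (htI' i) (by linarith [htm hij])))
    (fun _ => measurableSet_Iic) (m := N)
    fun j _ => by rw [hb.measureReal_Iic (htI' j)]; linarith [ht1 j]
  refine ⟨fun ω => D₁ ω + D₂ ω, hi₁.add hi₂, ?_, fun ω => add_nonneg (h0₁ ω) (h0₂ ω), ?_⟩
  · rw [integral_add hi₁ hi₂]
    have : (16 : ℝ) / N = 8 / N + 8 / N := by ring
    linarith
  intro ω j hj
  refine Real.abs_le_sqrt ?_
  rcases le_total j N with hjN | hjN
  · have h := hD₁ ω j hjN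
    have htj : t j = j / (2 * N : ℕ) := by simp only [ht, min_eq_left hjN]
    rw [hb.measureReal_Ioi (htI j), htj] at h
    have hc : empAvg ((Ioi (b (j / (2 * N : ℕ)))).indicator 1) ω
        = 1 - empAvg ((Iic (b (j / (2 * N : ℕ)))).indicator 1) ω := by
      have : ∀ x, (Ioi (b (j / (2 * N : ℕ)))).indicator (1 : ℝ → ℝ) x
          = 1 - (Iic (b (j / (2 * N : ℕ)))).indicator (1 : ℝ → ℝ) x := fun x => by
        rw [← compl_Iic, indicator_compl, Pi.sub_apply, Pi.one_apply]
      simp only [empAvg, this, Finset.sum_sub_distrib, sub_div, Finset.sum_const,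
        Finset.card_univ, Fintype.card_fin, nsmul_eq_mul, mul_one, div_self hN'.ne']
    rw [hc] at h
    calc _ = (1 - empAvg ((Iic (b (j / (2 * N : ℕ)))).indicator 1) ω
          - (1 - j / (2 * N : ℕ))) ^ 2 := by ring
      _ ≤ D₁ ω := h
      _ ≤ _ := le_add_of_nonneg_right (h0₂ ω)
  · have h := hD₂ ω (2 * N - j) (by omega)
    have htj : 1 - t (2 * N - j) = j / (2 * N : ℕ) := by
      have : min (2 * N - j) N = 2 * N - j := by omega
      simp only [ht, this]
      rw [Nat.cast_sub hj]
      field_simp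
      ring
    rw [hb.measureReal_Iic (htI' _), htj] at h
    exact h.trans (le_add_of_nonneg_left (h0₁ ω))

lemma mse_le (hb : IsQuantileFunction ν b) {L : ℝ} (hL : 0 ≤ L)
    (hLip : ∀ p ∈ Icc (0 : ℝ) 1, ∀ q ∈ Icc (0 : ℝ) 1, |b p - b q| ≤ L * |p - q|)
    {N : ℕ} (hN : 0 < N) :
    mse ν b N ≤ ENNReal.ofReal 9 * ENNReal.ofReal L / ENNReal.ofReal √(2 * (N : ℝ)) := by
  have hN' : (1 : ℝ) ≤ N := by exact_mod_cast hN
  obtain ⟨D, hi, hE, h0, hD⟩ := exists_grid_deviation hb hN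
  have hpt : ∀ᵐ ω ∂(Measure.pi fun _ : Fin N => ν),
      ⨆ q ∈ Ico (0 : ℝ) 1, ENNReal.ofReal (|b q - bidEstimator ω q| ^ 2)
        ≤ ENNReal.ofReal (L ^ 2 * (2 * D ω + 1 / 2 / N)) := by
    filter_upwards [ae_forall_mem_image hb N] with ω hω
    refine iSup₂_le fun q hq => ENNReal.ofReal_le_ofReal ?_
    have hqN : 0 ≤ q * N := mul_nonneg hq.1 (by linarith)
    have hfl : ⌊q * N⌋₊ < N := by
      rw [Nat.floor_lt hqN]
      nlinarith [hq.2]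
    rw [bidEstimator_eq ω hfl (Nat.floor_le hqN) (Nat.lt_floor_add_one _)]
    obtain ⟨u, hu, hbu⟩ := hω (Tuple.sort ω ⟨⌊q * N⌋₊, hfl⟩)
    have h1 := abs_sub_le_of_grid ω hb.strictMonoOn (M := 2 * N) (by omega) (hD ω)
      ⟨⌊q * N⌋₊, hfl⟩ hu hbu hq.1 (Nat.floor_le hqN) (Nat.lt_floor_add_one _).le
    have h2 := (hLip q (Ico_subset_Icc_self hq) u hu).trans (mul_le_mul_of_nonneg_left h1 hL)
    rw [← hbu]
    have h3 : (√(D ω) + 1 / (2 * N : ℕ)) ^ 2 ≤ 2 * D ω + 1 / 2 / N := by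
      have e1 := Real.sq_sqrt (h0 ω)
      have e2 : ((1 : ℝ) / (2 * N : ℕ)) ^ 2 ≤ 1 / 4 / N := by
        push_cast
        rw [div_pow, one_pow, div_div, div_le_div_iff₀ (by positivity) (by positivity)]
        nlinarith
      have e3 : (1 : ℝ) / 2 / N = 2 * (1 / 4 / N) := by ring
      nlinarith [sq_nonneg (√(D ω) - 1 / (2 * N : ℕ))]
    calc |b q - b u| ^ 2 ≤ (L * (√(D ω) + 1 / (2 * N : ℕ))) ^ 2 :=
          pow_le_pow_left₀ (abs_nonneg _) h2 2
      _ = L ^ 2 * (√(D ω) + 1 / (2 * N : ℕ)) ^ 2 := mul_pow _ _ _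
      _ ≤ _ := mul_le_mul_of_nonneg_left h3 (sq_nonneg _)
  have hint : Integrable (fun ω => L ^ 2 * (2 * D ω + 1 / 2 / N)) (Measure.pi fun _ => ν) :=
    ((hi.const_mul 2).add (integrable_const _)).const_mul _
  have hval : ∫ ω, L ^ 2 * (2 * D ω + 1 / 2 / N) ∂(Measure.pi fun _ => ν)
      ≤ (9 * L / √(2 * N)) ^ 2 := by
    rw [integral_const_mul, integral_add (hi.const_mul 2) (integrable_const _),
      integral_const_mul, div_pow, Real.sq_sqrt (by positivity), mul_pow, mul_comm (9 ^ 2),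
      mul_div_assoc]
    refine mul_le_mul_of_nonneg_left ?_ (sq_nonneg _)
    simp only [integral_const, probReal_univ, smul_eq_mul, one_mul]
    calc 2 * ∫ ω, D ω ∂(Measure.pi fun _ => ν) + 1 / 2 / (N : ℝ)
        ≤ 2 * (16 / N) + 1 / 2 / N := by gcongr
      -- The absolute constant `9` comes from here: `65 ≤ 9 ^ 2`.
      _ = 65 / (2 * N) := by field_simp; norm_num
      _ ≤ 9 ^ 2 / (2 * N) := by gcongr; norm_num
  have hnn : 0 ≤ 9 * L / √(2 * N) := by positivity
  calc mse ν b N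
      ≤ (ENNReal.ofReal ((9 * L / √(2 * N)) ^ 2)) ^ (1 / 2 : ℝ) := by
        refine ENNReal.rpow_le_rpow ?_ (by norm_num)
        refine (lintegral_mono_ae hpt).trans ?_
        rw [← ofReal_integral_eq_lintegral_ofReal hint
          (ae_of_all _ fun ω => by have := h0 ω; positivity)]
        exact ENNReal.ofReal_le_ofReal hval
    _ = ENNReal.ofReal (9 * L / √(2 * N)) := by
        rw [ENNReal.ofReal_rpow_of_nonneg (sq_nonneg _) (by norm_num), ← Real.sqrt_eq_rpow,
          Real.sqrt_sq hnn]
    _ = _ := by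
        rw [ENNReal.ofReal_div_of_pos (by positivity), ENNReal.ofReal_mul (by norm_num)]

/-- The indicator of a sample being at most `b q₀` has variance `q₀ (1 - q₀)`, and
`exists_le_abs_sub_bidEstimator` converts its empirical deviation into an error of the estimator. -/
lemma le_mse (hb : IsQuantileFunction ν b) {κ q₀ : ℝ} (hκ : 0 < κ) (hq₀ : q₀ ∈ Ioo (0 : ℝ) 1)
    (hlow : ∀ q ∈ Icc (0 : ℝ) q₀, κ * (q₀ - q) ≤ b q₀ - b q)
    (hup : ∀ q ∈ Icc q₀ 1, κ * (q - q₀) ≤ b q - b q₀) {N : ℕ} (hN : 0 < N) :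
    ENNReal.ofReal (κ / 2 * √(q₀ * (1 - q₀)) / √N) ≤ mse ν b N := by
  have hq' : 0 < 1 - q₀ := by linarith [hq₀.2]
  have hq0 := hq₀.1
  set f : ℝ → ℝ := fun x => (Iic (b q₀)).indicator 1 x - q₀ with hf
  have hfm : Measurable f := (measurable_one.indicator measurableSet_Iic).sub_const _
  have hind : ∀ x, (Iic (b q₀)).indicator (1 : ℝ → ℝ) x = 0 ∨
      (Iic (b q₀)).indicator (1 : ℝ → ℝ) x = 1 := fun x => by
    by_cases hx : x ≤ b q₀ <;> simp [hx]
  have hfb : ∀ x, |f x| ≤ 1 := fun x => by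
    rcases hind x with h | h <;> simp only [hf, h, abs_le] <;> constructor <;> linarith
  have hI : Integrable ((Iic (b q₀)).indicator (1 : ℝ → ℝ)) ν :=
    (integrable_const (1 : ℝ)).indicator measurableSet_Iic
  have hIv : ∫ x, (Iic (b q₀)).indicator (1 : ℝ → ℝ) x ∂ν = q₀ := by
    rw [integral_indicator_one measurableSet_Iic, hb.measureReal_Iic ⟨hq0.le, hq₀.2.le⟩]
  have h0 : ∫ x, f x ∂ν = 0 := by
    simp only [hf]
    rw [integral_sub hI (integrable_const _), hIv]
    simp
  have hsq : ∫ x, f x ^ 2 ∂ν = q₀ * (1 - q₀) := by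
    have : ∀ x, f x ^ 2 = (1 - 2 * q₀) * (Iic (b q₀)).indicator (1 : ℝ → ℝ) x + q₀ ^ 2 :=
      fun x => by rcases hind x with h | h <;> simp only [hf, h] <;> ring
    simp only [this]
    rw [integral_add (hI.const_mul _) (integrable_const _), integral_const_mul, hIv]
    simp
    ring
  have hV := integral_sq_empAvg ν hN (MemLp.of_bound hfm.aestronglyMeasurable 1 (ae_of_all _ hfb)) h0
  rw [hsq] at hV
  have hN' : (0 : ℝ) < N := by exact_mod_cast hN
  have hemp : ∀ ω : Fin N → ℝ, empAvg f ω = empAvg ((Iic (b q₀)).indicator 1) ω - q₀ := fun ω => by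
    simp only [empAvg, hf, Finset.sum_sub_distrib, sub_div, Finset.sum_const, Finset.card_univ,
      Fintype.card_fin, nsmul_eq_mul]
    field_simp
  have hpt : ∀ ω : Fin N → ℝ, ENNReal.ofReal ((κ / 2) ^ 2 * empAvg f ω ^ 2)
      ≤ ⨆ q ∈ Ico (0 : ℝ) 1, ENNReal.ofReal (|b q - bidEstimator ω q| ^ 2) := fun ω => by
    obtain ⟨q, hq, h⟩ := exists_le_abs_sub_bidEstimator ω hN hκ hq₀ hlow hup
    refine le_trans (ENNReal.ofReal_le_ofReal ?_)
      (le_iSup₂ (f := fun q (_ : q ∈ Ico (0 : ℝ) 1) =>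
        ENNReal.ofReal (|b q - bidEstimator ω q| ^ 2)) q hq)
    calc (κ / 2) ^ 2 * empAvg f ω ^ 2 = (κ * (|empAvg f ω| / 2)) ^ 2 := by
          rw [← sq_abs (empAvg f ω)]; ring
      _ ≤ _ := pow_le_pow_left₀ (by positivity) (by rw [hemp]; exact h) 2
  have hint : Integrable (fun ω : Fin N → ℝ => (κ / 2) ^ 2 * empAvg f ω ^ 2)
      (Measure.pi fun _ => ν) := by
    refine (Integrable.of_bound ((measurable_empAvg hfm).pow_const 2).aestronglyMeasurable 1
      (ae_of_all _ fun ω => ?_)).const_mul _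
    rw [Real.norm_of_nonneg (sq_nonneg _), sq_le_one_iff_abs_le_one]
    exact abs_empAvg_le zero_le_one hfb ω
  have hnn : 0 ≤ κ / 2 * √(q₀ * (1 - q₀)) / √N := by positivity
  have hval : ∫ ω : Fin N → ℝ, (κ / 2) ^ 2 * empAvg f ω ^ 2 ∂(Measure.pi fun _ => ν)
      = (κ / 2 * √(q₀ * (1 - q₀)) / √N) ^ 2 := by
    rw [integral_const_mul, hV, div_pow _ √(N : ℝ), mul_pow, Real.sq_sqrt (by positivity),
      Real.sq_sqrt hN'.le]
    ring
  calc ENNReal.ofReal (κ / 2 * √(q₀ * (1 - q₀)) / √N)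
      = (ENNReal.ofReal ((κ / 2 * √(q₀ * (1 - q₀)) / √N) ^ 2)) ^ (1 / 2 : ℝ) := by
        rw [ENNReal.ofReal_rpow_of_nonneg (sq_nonneg _) (by norm_num), ← Real.sqrt_eq_rpow,
          Real.sqrt_sq hnn]
    _ ≤ mse ν b N := by
        refine ENNReal.rpow_le_rpow ?_ (by norm_num)
        rw [← hval, ofReal_integral_eq_lintegral_ofReal hint (ae_of_all _ fun ω => by positivity)]
        exact lintegral_mono hpt

/-! ### Lipschitz constant and linear growth of a continuously differentiable bid function -/

lemma differentiableAt_of_contDiffOn (hd : ContDiffOn ℝ 1 b (Icc 0 1)) {q : ℝ}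
    (hq : q ∈ Ioo (0 : ℝ) 1) : DifferentiableAt ℝ b q :=
  (hd.differentiableOn one_ne_zero).differentiableAt (Icc_mem_nhds hq.1 hq.2)

lemma quantileSup_deriv_ne_top (hd : ContDiffOn ℝ 1 b (Icc 0 1)) :
    quantileSup (fun q => deriv b q) ≠ ∞ := by
  have hc := hd.continuousOn_derivWithin (uniqueDiffOn_Icc zero_lt_one) le_rfl
  obtain ⟨C, hC⟩ := (isCompact_Icc.image_of_continuousOn hc).bddAbove
  refine ne_top_of_le_ne_top (b := ENNReal.ofReal C) ENNReal.ofReal_ne_top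
    (iSup₂_le fun q hq => ENNReal.ofReal_le_ofReal ?_)
  change deriv b q ≤ C
  rw [← derivWithin_of_mem_nhds (Icc_mem_nhds hq.1 hq.2)]
  exact hC (mem_image_of_mem _ (Ioo_subset_Icc_self hq))

lemma abs_sub_le_quantileSup_deriv (hm : MonotoneOn b (Icc 0 1))
    (hd : ContDiffOn ℝ 1 b (Icc 0 1)) {p q : ℝ} (hp : p ∈ Icc (0 : ℝ) 1) (hq : q ∈ Icc (0 : ℝ) 1) :
    |b p - b q| ≤ (quantileSup fun q => deriv b q).toReal * |p - q| := by
  wlog hpq : q ≤ p generalizing p q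
  · rw [abs_sub_comm, abs_sub_comm p]
    exact this hq hp (not_le.1 hpq).le
  rw [abs_of_nonneg (sub_nonneg.2 (hm hq hp hpq)), abs_of_nonneg (sub_nonneg.2 hpq)]
  refine (convex_Icc (0 : ℝ) 1).image_sub_le_mul_sub_of_deriv_le hd.continuousOn
    ((hd.differentiableOn one_ne_zero).mono interior_subset) (fun x hx => ?_) q hq p hp hpq
  rw [interior_Icc] at hx
  refine (Real.le_coe_toNNReal _).trans ?_
  exact ENNReal.toReal_mono (quantileSup_deriv_ne_top hd)
    (le_iSup₂ (f := fun q (_ : q ∈ Ioo (0 : ℝ) 1) => ENNReal.ofReal (deriv b q)) x hx)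

lemma mse_le_quantileSup_deriv (hb : IsQuantileFunction ν b) (hd : ContDiffOn ℝ 1 b (Icc 0 1))
    {N : ℕ} (hN : 0 < N) :
    mse ν b N ≤ ENNReal.ofReal 9 * quantileSup (fun q => deriv b q)
      / ENNReal.ofReal √(2 * (N : ℝ)) := by
  have := mse_le hb ENNReal.toReal_nonneg
    (fun p hp q hq => abs_sub_le_quantileSup_deriv hb.strictMonoOn.monotoneOn hd hp hq) hN
  rwa [ENNReal.ofReal_toReal (quantileSup_deriv_ne_top hd)] at this

/-- The mean value theorem gives `q₀` with `b' q₀ = b 1 - b 0 > 0`. The difference quotient at `q₀`,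
extended by this derivative, is continuous and positive on `[0, 1]`; its minimum is `κ`. -/
lemma exists_linear_growth (hm : StrictMonoOn b (Icc 0 1)) (hd : ContDiffOn ℝ 1 b (Icc 0 1)) :
    ∃ q₀ ∈ Ioo (0 : ℝ) 1, ∃ κ > 0, (∀ q ∈ Icc (0 : ℝ) q₀, κ * (q₀ - q) ≤ b q₀ - b q) ∧
      ∀ q ∈ Icc q₀ 1, κ * (q - q₀) ≤ b q - b q₀ := by
  obtain ⟨q₀, hq₀, hder⟩ := exists_deriv_eq_slope b zero_lt_one hd.continuousOn
    fun q hq => (differentiableAt_of_contDiffOn hd hq).differentiableWithinAt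
  have hI : q₀ ∈ Icc (0 : ℝ) 1 := Ioo_subset_Icc_self hq₀
  have hpos : ∀ q ∈ Icc (0 : ℝ) 1, 0 < dslope b q₀ q := by
    intro q hq
    rcases lt_trichotomy q q₀ with h | rfl | h
    · rw [dslope_of_ne _ h.ne, slope_def_field]
      exact div_pos_of_neg_of_neg (sub_neg.2 (hm hq hI h)) (sub_neg.2 h)
    · rw [dslope_same, hder]
      have := hm (left_mem_Icc.2 zero_le_one) (right_mem_Icc.2 zero_le_one) (zero_lt_one' ℝ)
      simpa using this
    · rw [dslope_of_ne _ h.ne', slope_def_field]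
      exact div_pos (sub_pos.2 (hm hI hq h)) (sub_pos.2 h)
  have hcont : ContinuousOn (dslope b q₀) (Icc 0 1) :=
    (continuousOn_dslope (Icc_mem_nhds hq₀.1 hq₀.2)).2
      ⟨hd.continuousOn, differentiableAt_of_contDiffOn hd hq₀⟩
  obtain ⟨r, hr, hmin⟩ := isCompact_Icc.exists_isMinOn (nonempty_Icc.2 (zero_le_one' ℝ)) hcont
  refine ⟨q₀, hq₀, dslope b q₀ r, hpos r hr, fun q hq => ?_, fun q hq => ?_⟩
  · have h := hmin (show q ∈ Icc (0 : ℝ) 1 from ⟨hq.1, hq.2.trans hI.2⟩)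
    have e : (q - q₀) * dslope b q₀ q = b q - b q₀ := by
      simpa using sub_smul_dslope b q₀ q
    have := mul_le_mul_of_nonneg_right h (sub_nonneg.2 hq.2)
    linarith
  · have h := hmin (show q ∈ Icc (0 : ℝ) 1 from ⟨hI.1.trans hq.1, hq.2⟩)
    have e : (q - q₀) * dslope b q₀ q = b q - b q₀ := by
      simpa using sub_smul_dslope b q₀ q
    have := mul_le_mul_of_nonneg_right h (sub_nonneg.2 hq.1)
    linarith

lemma hasConvergenceRate_mse (hb : IsQuantileFunction ν b) (hd : ContDiffOn ℝ 1 b (Icc 0 1)) :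
    HasConvergenceRate (fun N => √(N : ℝ)) (mse ν b) := by
  obtain ⟨q₀, hq₀, κ, hκ, hlow, hup⟩ := exists_linear_growth hb.strictMonoOn hd
  have hq0 := hq₀.1
  have hq1 : 0 < 1 - q₀ := by linarith [hq₀.2]
  set L := (quantileSup fun q => deriv b q).toReal with hL
  refine ⟨κ / 2 * √(q₀ * (1 - q₀)), 9 * L, by positivity, ?_⟩
  filter_upwards [eventually_gt_atTop 0] with N hN
  have hN' : (0 : ℝ) < N := by exact_mod_cast hN
  have hs : 0 < √(N : ℝ) := Real.sqrt_pos.2 hN'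
  constructor
  · refine le_trans (le_of_eq ?_) (mul_le_mul_right (le_mse hb hκ hq₀ hlow hup hN) _)
    rw [← ENNReal.ofReal_mul hs.le, mul_div_cancel₀ _ hs.ne']
  · have h := mse_le hb (L := L) ENNReal.toReal_nonneg
      (fun p hp q hq => abs_sub_le_quantileSup_deriv hb.strictMonoOn.monotoneOn hd hp hq) hN
    rw [← ENNReal.ofReal_mul (by norm_num), ← ENNReal.ofReal_div_of_pos (by positivity)] at h
    refine (mul_le_mul_right h _).trans ?_
    rw [← ENNReal.ofReal_mul hs.le]
    refine ENNReal.ofReal_le_ofReal ?_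
    have hL0 : 0 ≤ L := ENNReal.toReal_nonneg
    have : √(N : ℝ) ≤ √(2 * N) := Real.sqrt_le_sqrt (by linarith)
    rw [mul_div_assoc', div_le_iff₀ (by positivity), mul_comm]
    gcongr

end Error

/-! ## Value distributions -/

section Values

variable {F : Measure ℝ} [IsProbabilityMeasure F] {v : ℝ → ℝ}

/-- `Iic (v (q / 2))` has mass `q / 2 > 0` and so meets `[0, 1]`; strict monotonicity then makes `v
q` positive. -/
lemma IsQuantileFunction.pos (hv : IsQuantileFunction F v) (hF : F (Icc 0 1) = 1) {q : ℝ}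
    (hq : q ∈ Ioc (0 : ℝ) 1) : 0 < v q := by
  have h2 : q / 2 ∈ Icc (0 : ℝ) 1 := ⟨by linarith [hq.1], by linarith [hq.1, hq.2]⟩
  refine lt_of_le_of_lt ?_ (hv.strictMonoOn h2 (Ioc_subset_Icc_self hq) (by linarith [hq.1]))
  by_contra hcon
  have hsub : Iic (v (q / 2)) ⊆ (Icc 0 1)ᶜ := fun x hx hx' =>
    absurd (hx'.1.trans hx) hcon
  have h0 : F (Icc 0 1)ᶜ = 0 := (prob_compl_eq_zero_iff measurableSet_Icc).2 hF
  have := hv.measureReal_Iic h2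
  rw [measureReal_def, measure_mono_null hsub h0] at this
  simp at this
  linarith [hq.1]

lemma IsQuantileFunction.le_one (hv : IsQuantileFunction F v) (hF : F (Icc 0 1) = 1) {q : ℝ}
    (hq : q ∈ Ico (0 : ℝ) 1) : v q ≤ 1 := by
  by_contra hcon
  have hsub : Ioi (v q) ⊆ (Icc 0 1)ᶜ := fun x hx hx' =>
    absurd (lt_of_lt_of_le hx hx'.2).le hcon
  have h0 : F (Icc 0 1)ᶜ = 0 := (prob_compl_eq_zero_iff measurableSet_Icc).2 hF
  have := hv.measureReal_Ioi (Ico_subset_Icc_self hq)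
  rw [measureReal_def, measure_mono_null hsub h0] at this
  simp at this
  linarith [hq.2]

/-- Every interval to the right of `v q` carries mass `p - q > 0`. Membership makes the equilibrium
condition, imposed only on the support, available at `v q`. -/
lemma IsQuantileFunction.mem_support (hv : IsQuantileFunction F v) {q : ℝ}
    (hq : q ∈ Ioo (0 : ℝ) 1) : v q ∈ F.support := by
  have hqI := Ioo_subset_Icc_self hq
  refine (Measure.mem_support_iff_forall _).2 fun U hU => ?_
  obtain ⟨ε, hε, hball⟩ := Metric.mem_nhds_iff.1 hU
  have hcont : ContinuousAt v q := hv.continuousOn.continuousAt (Icc_mem_nhds hq.1 hq.2)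
  have hev : ∀ᶠ p in nhds q, v p ∈ Metric.ball (v q) ε ∧ p < 1 :=
    (hcont.eventually_mem (Metric.ball_mem_nhds _ hε)).and (eventually_lt_nhds hq.2)
  have hev' : ∀ᶠ p in nhdsWithin q (Ioi q), (v p ∈ Metric.ball (v q) ε ∧ p < 1) ∧ q < p :=
    (hev.filter_mono nhdsWithin_le_nhds).and self_mem_nhdsWithin
  obtain ⟨p, ⟨hpball, hp1⟩, hqp⟩ := hev'.exists
  have hpI : p ∈ Icc (0 : ℝ) 1 := ⟨(hq.1.trans hqp).le, hp1.le⟩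
  have hsub : Iic (v p) \ Iic (v q) ⊆ U := by
    rintro x ⟨hx1, hx2⟩
    refine hball ?_
    simp only [mem_Iic, not_le] at hx1 hx2
    rw [Metric.mem_ball, Real.dist_eq, abs_lt] at hpball ⊢
    constructor <;> linarith [hpball.2]
  refine lt_of_lt_of_le ?_ (measure_mono hsub)
  have hle : Iic (v q) ⊆ Iic (v p) := Iic_subset_Iic.2 (hv.strictMonoOn hqI hpI hqp).le
  have hreal := measureReal_sdiff (μ := F) hle measurableSet_Iic
  rw [hv.measureReal_Iic hqI, hv.measureReal_Iic hpI] at hreal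
  refine pos_iff_ne_zero.2 fun h0 => ?_
  rw [measureReal_def, h0] at hreal
  simp at hreal
  linarith

/-- The bid function `s ∘ v` is the quantile function of the bids. -/
lemma IsQuantileFunction.map (hv : IsQuantileFunction F v) {s : ℝ → ℝ} (hs : Measurable s)
    (hm : StrictMonoOn (fun q => s (v q)) (Icc 0 1))
    (hc : ContinuousOn (fun q => s (v q)) (Icc 0 1)) :
    IsQuantileFunction (F.map s) fun q => s (v q) where
  cdf_apply q hq := by
    have := Measure.isProbabilityMeasure_map (μ := F) hs.aemeasurable
    rw [cdf_eq_real, map_measureReal_apply hs measurableSet_Iic]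
    refine Eq.trans (measureReal_congr ?_) (hv.measureReal_Iic hq)
    -- `s` is known to be increasing only along `v`, so the events are compared at values `v p`,
    -- which occur almost surely.
    filter_upwards [hv.ae_mem_image] with x hx
    obtain ⟨p, hp, rfl⟩ := hx
    exact propext ((hm.le_iff_le hp hq).trans (hv.strictMonoOn.le_iff_le hp hq).symm)
  continuousOn := hc

end Values

/-! ## Interim allocations -/

section Interim

variable {n : ℕ}

lemma one_le_numTied (bids : Fin n → ℝ) (i : Fin n) : 1 ≤ numTied bids i :=
  Finset.card_pos.2 ⟨i, by simp⟩

lemma measurable_rankAlloc (w : Fin n → ℝ) (i : Fin n) :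
    Measurable fun bids : Fin n → ℝ => rankAlloc w bids i := by
  have h1 : Measurable fun bids : Fin n → ℝ => numAbove bids i := by
    simp only [numAbove, Finset.card_filter]
    exact Finset.measurable_sum _ fun j _ => Measurable.ite
      (measurableSet_lt (measurable_pi_apply i) (measurable_pi_apply j))
      measurable_const measurable_const
  have h2 : Measurable fun bids : Fin n → ℝ => numTied bids i := by
    simp only [numTied, Finset.card_filter]
    exact Finset.measurable_sum _ fun j _ => Measurable.ite
      (measurableSet_eq_fun (measurable_pi_apply j) (measurable_pi_apply i))
      measurable_const measurable_const
  have hG : Measurable fun a : ℕ × ℕ => (∑ k ∈ Finset.univ.filter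
      (fun k : Fin n => a.1 ≤ (k : ℕ) ∧ (k : ℕ) < a.1 + a.2), w k) / (a.2 : ℝ) :=
    Measurable.of_discrete
  have h := hG.comp (h1.prodMk h2)
  unfold Function.comp at h
  unfold rankAlloc
  exact h

lemma rankAlloc_nonneg {w : Fin n → ℝ} (hw : ∀ k, w k ∈ Icc (0 : ℝ) 1) (bids : Fin n → ℝ)
    (i : Fin n) : 0 ≤ rankAlloc w bids i :=
  div_nonneg (Finset.sum_nonneg fun k _ => (hw k).1) (Nat.cast_nonneg _)

/-- A crude bound, used only for integrability. -/
lemma rankAlloc_le {w : Fin n → ℝ} (hw : ∀ k, w k ∈ Icc (0 : ℝ) 1) (bids : Fin n → ℝ)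
    (i : Fin n) : rankAlloc w bids i ≤ n := by
  have h1 : (1 : ℝ) ≤ numTied bids i := by exact_mod_cast one_le_numTied bids i
  refine (div_le_self (Finset.sum_nonneg fun k _ => (hw k).1) h1).trans ?_
  calc _ ≤ ∑ k, w k :=
        Finset.sum_le_sum_of_subset_of_nonneg (Finset.filter_subset _ _) fun k _ _ => (hw k).1
    _ ≤ ∑ _k : Fin n, (1 : ℝ) := Finset.sum_le_sum fun k _ => (hw k).2
    _ = n := by simp

/-- If no other agent bids the same as agent `i` then `i` has a definite rank. -/
lemma rankAlloc_eq_of_numTied_eq_one (w : Fin n → ℝ) {bids : Fin n → ℝ} {i k : Fin n}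
    (hk : numAbove bids i = k) (ht : numTied bids i = 1) : rankAlloc w bids i = w k := by
  have : (Finset.univ.filter fun l : Fin n => (k : ℕ) ≤ (l : ℕ) ∧ (l : ℕ) < k + 1) = {k} := by
    ext l
    simp only [Finset.mem_filter, Finset.mem_univ, true_and, Finset.mem_singleton, Fin.ext_iff]
    omega
  rw [rankAlloc, hk, ht, this]
  simp

variable {F : Measure ℝ}

lemma interimPay_firstPrice (w : Fin n → ℝ) (s : Fin n → ℝ → ℝ) (i : Fin n) (z : ℝ) :
    interimPay (firstPrice w) F s i z = z * interimAlloc (firstPrice w) F s i z := by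
  simp only [interimPay, interimAlloc, firstPrice, Function.update_self]
  exact integral_const_mul _ _

variable [IsProbabilityMeasure F]

lemma interimPay_allPay (w : Fin n → ℝ) (s : Fin n → ℝ → ℝ) (i : Fin n) (z : ℝ) :
    interimPay (allPay w) F s i z = z := by
  simp [interimPay, allPay]

/-- A bid which every other agent overbids and underbids with positive probability is served with
positive probability. -/
lemma integral_rankAlloc_pos {w : Fin n → ℝ} (hw : ∀ k, w k ∈ Icc (0 : ℝ) 1) (hw0 : w ≠ 0)
    {s : ℝ → ℝ} (hs : Measurable s) (i : Fin n) {z : ℝ}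
    (habove : F (s ⁻¹' Ioi z) ≠ 0) (hbelow : F (s ⁻¹' Iio z) ≠ 0) :
    0 < ∫ vals : Fin n → ℝ, rankAlloc w (Function.update (fun j => s (vals j)) i z) i
      ∂(Measure.pi fun _ => F) := by
  obtain ⟨k, hk⟩ := Function.ne_iff.1 hw0
  have hU : Measurable fun vals : Fin n → ℝ => Function.update (fun j => s (vals j)) i z := by
    refine measurable_pi_iff.2 fun j => ?_
    rcases eq_or_ne j i with rfl | hj
    · simp only [Function.update_self]
      exact measurable_const
    · simp only [Function.update_of_ne hj]
      exact hs.comp (measurable_pi_apply j)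
  have hm := (measurable_rankAlloc w i).comp hU
  rw [integral_pos_iff_support_of_nonneg (fun _ => rankAlloc_nonneg hw _ _)
    (Integrable.of_bound hm.aestronglyMeasurable n (ae_of_all _ fun vals => by
      rw [Real.norm_of_nonneg (rankAlloc_nonneg hw _ _)]
      exact rankAlloc_le hw _ _))]
  -- Pick `k` opponents to bid above `z` and let the others bid below. This product event has
  -- positive probability, and on it agent `i` has the rank `k` with `w k ≠ 0`.
  obtain ⟨J, hJ, hJk⟩ := Finset.exists_subset_card_eq (s := Finset.univ.erase i) (n := (k : ℕ)) (by
    rw [Finset.card_erase_of_mem (Finset.mem_univ _), Finset.card_univ, Fintype.card_fin]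
    omega)
  have hiJ : i ∉ J := fun h => by simpa using hJ h
  set E : Fin n → Set ℝ := fun j =>
    if j = i then univ else if j ∈ J then s ⁻¹' Ioi z else s ⁻¹' Iio z with hE
  have hpos : 0 < Measure.pi (fun _ : Fin n => F) (univ.pi E) := by
    rw [Measure.pi_pi, pos_iff_ne_zero, Finset.prod_ne_zero_iff]
    intro j _
    simp only [hE]
    split_ifs
    · simp
    · exact habove
    · exact hbelow
  refine hpos.trans_le (measure_mono fun vals hvals => ?_)
  set bids := Function.update (fun j => s (vals j)) i z with hbids
  have hbi : bids i = z := Function.update_self _ _ _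
  have hbJ : ∀ j ∈ J, z < bids j := fun j hj => by
    have hji : j ≠ i := fun h => hiJ (h ▸ hj)
    have := hvals j (mem_univ _)
    simp only [hE, if_neg hji, if_pos hj] at this
    rw [hbids, Function.update_of_ne hji]
    exact this
  have hbJ' : ∀ j ∉ J, j ≠ i → bids j < z := fun j hj hji => by
    have := hvals j (mem_univ _)
    simp only [hE, if_neg hji, if_neg hj] at this
    rw [hbids, Function.update_of_ne hji]
    exact this
  have hA : numAbove bids i = k := by
    rw [← hJk, numAbove]
    congr 1
    ext j
    simp only [Finset.mem_filter, Finset.mem_univ, true_and, hbi]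
    refine ⟨fun h => ?_, hbJ j⟩
    by_contra hj
    rcases eq_or_ne j i with rfl | hji
    · rw [hbi] at h
      exact lt_irrefl _ h
    · exact lt_asymm h (hbJ' j hj hji)
  have hT : numTied bids i = 1 := by
    rw [numTied, Finset.card_eq_one]
    refine ⟨i, ?_⟩
    ext j
    simp only [Finset.mem_filter, Finset.mem_univ, true_and, Finset.mem_singleton]
    refine ⟨fun h => ?_, fun h => by rw [h]⟩
    by_contra hji
    rw [hbi] at h
    by_cases hj : j ∈ J
    · exact (hbJ j hj).ne' h
    · exact (hbJ' j hj hji).ne h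
  rw [Function.mem_support, rankAlloc_eq_of_numTied_eq_one w hA hT]
  exact hk

end Interim

/-! ## Derivatives of bids and allocations in equilibrium -/

open scoped Topology

lemma hasDerivAt_of_sub_squeeze {f g α β : ℝ → ℝ} {q a g' : ℝ} (hg : HasDerivAt g g' q)
    (hα : Tendsto α (𝓝[≠] q) (𝓝 a)) (hβ : Tendsto β (𝓝[≠] q) (𝓝 a))
    (h : ∀ᶠ p in 𝓝[≠] q, α p * (g p - g q) ≤ f p - f q ∧ f p - f q ≤ β p * (g p - g q)) :
    HasDerivAt f (a * g') q := by
  rw [hasDerivAt_iff_tendsto_slope] at hg ⊢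
  have h1 := hα.mul hg
  have h2 := hβ.mul hg
  -- Dividing by `p - q` reverses the inequalities when `p < q`; the minimum and maximum of the two
  -- bounds serve both sides.
  have hmin := h1.min h2
  have hmax := h1.max h2
  rw [min_self] at hmin
  rw [max_self] at hmax
  refine tendsto_of_tendsto_of_tendsto_of_le_of_le' hmin hmax ?_ ?_
  all_goals
    filter_upwards [h, self_mem_nhdsWithin] with p hp hpq
    simp only [slope_def_field, ← mul_div_assoc]
    rcases lt_or_gt_of_ne hpq with hlt | hlt
  · exact (min_le_right _ _).trans ((div_le_div_right_of_neg (sub_neg.2 hlt)).2 hp.2)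
  · exact (min_le_left _ _).trans (div_le_div_of_nonneg_right hp.1 (sub_pos.2 hlt).le)
  · exact ((div_le_div_right_of_neg (sub_neg.2 hlt)).2 hp.1).trans (le_max_left _ _)
  · exact (div_le_div_of_nonneg_right hp.2 (sub_pos.2 hlt).le).trans (le_max_right _ _)

section Equilibrium

variable {v b x : ℝ → ℝ}

lemma hasDerivAt_alloc_of_allPay (hvpos : ∀ q ∈ Ioo (0 : ℝ) 1, 0 < v q)
    (hmax : ∀ q ∈ Ioo (0 : ℝ) 1, ∀ p ∈ Ioo (0 : ℝ) 1, v q * x p - b p ≤ v q * x q - b q)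
    {q b' : ℝ} (hq : q ∈ Ioo (0 : ℝ) 1) (hv : ContinuousAt v q) (hb : HasDerivAt b b' q) :
    HasDerivAt x (b' / v q) q := by
  have hvq := hvpos q hq
  rw [div_eq_inv_mul]
  refine hasDerivAt_of_sub_squeeze (α := fun p => (v p)⁻¹) (β := fun _ => (v q)⁻¹) hb
    ((hv.inv₀ hvq.ne').tendsto.mono_left nhdsWithin_le_nhds) tendsto_const_nhds ?_
  filter_upwards [nhdsWithin_le_nhds (Ioo_mem_nhds hq.1 hq.2)] with p hp
  have h1 := hmax q hq p hp
  have h2 := hmax p hp q hq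
  rw [inv_mul_le_iff₀ (hvpos p hp), le_inv_mul_iff₀ hvq]
  constructor <;> linarith

/-- Adding the two incentive constraints gives `(v q - v p) (x q - x p) ≥ 0`. -/
lemma alloc_monotone_of_firstPrice (hv : StrictMonoOn v (Ioo 0 1))
    (hmax : ∀ q ∈ Ioo (0 : ℝ) 1, ∀ p ∈ Ioo (0 : ℝ) 1, (v q - b p) * x p ≤ (v q - b q) * x q) :
    MonotoneOn x (Ioo 0 1) := by
  intro p hp q hq hpq
  rcases hpq.eq_or_lt with rfl | hlt
  · exact le_rfl
  by_contra hcon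
  have h1 := hmax q hq p hp
  have h2 := hmax p hp q hq
  nlinarith [mul_pos (sub_pos.2 (hv hp hq hlt)) (sub_pos.2 (not_le.1 hcon))]

/-- An agent with `b q ≥ v q` would do better with the bid of quantile `q / 2`: it pays strictly
less upon winning and wins no more often. -/
lemma bid_lt_value_of_firstPrice (hv : StrictMonoOn v (Ioo 0 1)) (hb : StrictMonoOn b (Ioo 0 1))
    (hx : ∀ q ∈ Ioo (0 : ℝ) 1, 0 < x q)
    (hmax : ∀ q ∈ Ioo (0 : ℝ) 1, ∀ p ∈ Ioo (0 : ℝ) 1, (v q - b p) * x p ≤ (v q - b q) * x q)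
    {q : ℝ} (hq : q ∈ Ioo (0 : ℝ) 1) : b q < v q := by
  have hp : q / 2 ∈ Ioo (0 : ℝ) 1 := ⟨by linarith [hq.1], by linarith [hq.1, hq.2]⟩
  have hlt : q / 2 < q := by linarith [hq.1]
  have h1 := hmax q hq _ hp
  have h2 := alloc_monotone_of_firstPrice hv hmax hp hq hlt.le
  have h3 := mul_pos (hx _ hp) (sub_pos.2 (hb hp hq hlt))
  by_contra hcon
  nlinarith [mul_nonneg (sub_nonneg.2 (not_lt.1 hcon)) (sub_nonneg.2 h2)]

lemma hasDerivAt_alloc_of_firstPrice (hv : StrictMonoOn v (Ioo 0 1))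
    (hb : StrictMonoOn b (Ioo 0 1)) (hx : ∀ q ∈ Ioo (0 : ℝ) 1, 0 < x q)
    (hmax : ∀ q ∈ Ioo (0 : ℝ) 1, ∀ p ∈ Ioo (0 : ℝ) 1, (v q - b p) * x p ≤ (v q - b q) * x q)
    {q b' : ℝ} (hq : q ∈ Ioo (0 : ℝ) 1) (hvq : ContinuousAt v q) (hbq : HasDerivAt b b' q) :
    HasDerivAt x (x q / (v q - b q) * b') q := by
  have hpos : ∀ p ∈ Ioo (0 : ℝ) 1, 0 < v p - b p := fun p hp =>
    sub_pos.2 (bid_lt_value_of_firstPrice hv hb hx hmax hp)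
  have hbounds : ∀ p ∈ Ioo (0 : ℝ) 1, x q / (v p - b p) * (b p - b q) ≤ x p - x q ∧
      x p - x q ≤ x p / (v q - b q) * (b p - b q) := by
    intro p hp
    have h1 := hmax q hq p hp
    have h2 := hmax p hp q hq
    rw [div_mul_eq_mul_div, div_mul_eq_mul_div, div_le_iff₀ (hpos p hp), le_div_iff₀ (hpos q hq)]
    constructor <;> linarith
  have hIoo : ∀ᶠ p in 𝓝 q, p ∈ Ioo (0 : ℝ) 1 := Ioo_mem_nhds hq.1 hq.2
  have hα : Tendsto (fun p => x q / (v p - b p)) (𝓝 q) (𝓝 (x q / (v q - b q))) :=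
    tendsto_const_nhds.div (hvq.sub hbq.continuousAt).tendsto (hpos q hq).ne'
  have hb0 : Tendsto (fun p => b p - b q) (𝓝 q) (𝓝 0) := by
    simpa using hbq.continuousAt.tendsto.sub_const (b q)
  -- The upper bound on `x p - x q` contains `x p`, so continuity of `x` at `q` has to come first.
  -- Monotonicity bounds `x p` by `x r` near `q`, which is enough.
  obtain ⟨r, hr⟩ := exists_between hq.2
  have hrI : r ∈ Ioo (0 : ℝ) 1 := ⟨hq.1.trans hr.1, hr.2⟩
  have hxb : Tendsto (fun p => x p / (v q - b q) * (b p - b q)) (𝓝 q) (𝓝 0) := by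
    have hlim : Tendsto (fun p => x r / (v q - b q) * |b p - b q|) (𝓝 q) (𝓝 0) := by
      simpa using hb0.abs.const_mul (x r / (v q - b q))
    refine squeeze_zero_norm' ?_ hlim
    filter_upwards [hIoo, eventually_lt_nhds hr.1] with p hp hpr
    rw [norm_mul, Real.norm_eq_abs, Real.norm_eq_abs,
      abs_of_pos (div_pos (hx p hp) (hpos q hq))]
    have := alloc_monotone_of_firstPrice hv hmax hp hrI hpr.le
    have := hpos q hq
    gcongr
  have hxc : Tendsto x (𝓝 q) (𝓝 (x q)) := by
    have hd : Tendsto (fun p => x p - x q) (𝓝 q) (𝓝 0) := by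
      have hlow := hα.mul hb0
      rw [mul_zero] at hlow
      refine tendsto_of_tendsto_of_tendsto_of_le_of_le' hlow hxb ?_ ?_
      · filter_upwards [hIoo] with p hp using (hbounds p hp).1
      · filter_upwards [hIoo] with p hp using (hbounds p hp).2
    simpa using hd.add_const (x q)
  exact hasDerivAt_of_sub_squeeze hbq (hα.mono_left nhdsWithin_le_nhds)
    ((hxc.div_const _).mono_left nhdsWithin_le_nhds)
    ((hIoo.filter_mono nhdsWithin_le_nhds).mono hbounds)

end Equilibrium

/-! ### Bounding `b'` by the allocation rule in each format -/

lemma quantileSup_mono {f g : ℝ → ℝ} (h : ∀ q ∈ Ioo (0 : ℝ) 1, f q ≤ g q) :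
    quantileSup f ≤ quantileSup g :=
  iSup₂_mono fun q hq => ENNReal.ofReal_le_ofReal (h q hq)

lemma deriv_nonneg_of_strictMonoOn {b : ℝ → ℝ} (hb : StrictMonoOn b (Icc 0 1)) {q : ℝ}
    (hq : q ∈ Ioo (0 : ℝ) 1) : 0 ≤ deriv b q := by
  rw [← derivWithin_of_mem_nhds (Icc_mem_nhds hq.1 hq.2)]
  exact hb.monotoneOn.derivWithin_nonneg

section Auction

variable {n : ℕ} {w : Fin n → ℝ} {F : Measure ℝ} [IsProbabilityMeasure F] {v s : ℝ → ℝ}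

lemma quantileSup_deriv_bid_le_firstPrice (hw : ∀ k, w k ∈ Icc (0 : ℝ) 1) (hw0 : w ≠ 0)
    (hF : F (Icc 0 1) = 1) (hv : IsQuantileFunction F v) (hs : Measurable s)
    (hm : StrictMonoOn (fun q => s (v q)) (Icc 0 1))
    (hd : ContDiffOn ℝ 1 (fun q => s (v q)) (Icc 0 1)) (i : Fin n)
    (hBN : IsBayesNash (firstPrice w) F fun _ => s) :
    quantileSup (fun q => deriv (fun q => s (v q)) q) ≤ quantileSup (fun q =>
      deriv (quantileAlloc (firstPrice w) F s v i) q / quantileAlloc (firstPrice w) F s v i q) := by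
  set x := quantileAlloc (firstPrice w) F s v i with hxdef
  set b := fun q => s (v q) with hbdef
  have hprob := Measure.isProbabilityMeasure_map (μ := F) hs.aemeasurable
  have hbq : IsQuantileFunction (F.map s) b := hv.map hs hm hd.continuousOn
  have hb0 : ∀ q ∈ Ioo (0 : ℝ) 1, 0 ≤ b q := fun q hq => (hBN i _ (hv.mem_support hq)).1
  have hx : ∀ q ∈ Ioo (0 : ℝ) 1, 0 < x q := by
    intro q hq
    refine integral_rankAlloc_pos hw hw0 hs i (z := b q) ?_ ?_
    · rw [← Measure.map_apply hs measurableSet_Ioi, ← measureReal_ne_zero_iff,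
        hbq.measureReal_Ioi (Ioo_subset_Icc_self hq)]
      linarith [hq.2]
    · have h2 : q / 2 ∈ Icc (0 : ℝ) 1 := ⟨by linarith [hq.1], by linarith [hq.1, hq.2]⟩
      rw [← Measure.map_apply hs measurableSet_Iio]
      intro h0
      have hsub : Iic (b (q / 2)) ⊆ Iio (b q) := Iic_subset_Iio.2
        (hm h2 (Ioo_subset_Icc_self hq) (by linarith [hq.1]))
      have := hbq.measureReal_Iic h2
      rw [measureReal_def, measure_mono_null hsub h0] at this
      simp at this
      linarith [hq.1]
  have hmax : ∀ q ∈ Ioo (0 : ℝ) 1, ∀ p ∈ Ioo (0 : ℝ) 1,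
      (v q - b p) * x p ≤ (v q - b q) * x q := by
    intro q hq p hp
    have := (hBN i _ (hv.mem_support hq)).2 (b p) (hb0 p hp)
    simp only [interimUtility, interimPay_firstPrice] at this
    rw [sub_mul, sub_mul]
    exact this
  have hvm := hv.strictMonoOn.mono Ioo_subset_Icc_self
  have hbm := hm.mono Ioo_subset_Icc_self
  refine quantileSup_mono fun q hq => ?_
  have hder := hasDerivAt_alloc_of_firstPrice hvm hbm hx hmax hq
    (hv.continuousOn.continuousAt (Icc_mem_nhds hq.1 hq.2))
    (differentiableAt_of_contDiffOn hd hq).hasDerivAt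
  have hlt : 0 < v q - b q := sub_pos.2 (bid_lt_value_of_firstPrice hvm hbm hx hmax hq)
  -- Values at most `1` and nonnegative bids enter here.
  have hle : v q - b q ≤ 1 := by
    linarith [hv.le_one hF (Ioo_subset_Ico_self hq), hb0 q hq]
  have hxq := hx q hq
  have hnn := deriv_nonneg_of_strictMonoOn hm hq
  have heq : x q / (v q - b q) * deriv b q / x q = deriv b q / (v q - b q) := by
    field_simp
  rw [hder.deriv, heq, le_div_iff₀ hlt]
  exact mul_le_of_le_one_right hnn hle

lemma quantileSup_deriv_bid_le_allPay
    (hF : F (Icc 0 1) = 1) (hv : IsQuantileFunction F v)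
    (hm : StrictMonoOn (fun q => s (v q)) (Icc 0 1))
    (hd : ContDiffOn ℝ 1 (fun q => s (v q)) (Icc 0 1)) (i : Fin n)
    (hBN : IsBayesNash (allPay w) F fun _ => s) :
    quantileSup (fun q => deriv (fun q => s (v q)) q)
      ≤ quantileSup (fun q => deriv (quantileAlloc (allPay w) F s v i) q) := by
  set x := quantileAlloc (allPay w) F s v i with hxdef
  set b := fun q => s (v q) with hbdef
  have hvpos : ∀ q ∈ Ioo (0 : ℝ) 1, 0 < v q := fun q hq => hv.pos hF (Ioo_subset_Ioc_self hq)
  have hmax : ∀ q ∈ Ioo (0 : ℝ) 1, ∀ p ∈ Ioo (0 : ℝ) 1,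
      v q * x p - b p ≤ v q * x q - b q := by
    intro q hq p hp
    have := (hBN i _ (hv.mem_support hq)).2 (b p) (hBN i _ (hv.mem_support hp)).1
    simp only [interimUtility, interimPay_allPay] at this
    exact this
  refine quantileSup_mono fun q hq => ?_
  have hder := hasDerivAt_alloc_of_allPay hvpos hmax hq
    (hv.continuousOn.continuousAt (Icc_mem_nhds hq.1 hq.2))
    (differentiableAt_of_contDiffOn hd hq).hasDerivAt
  rw [hder.deriv, le_div_iff₀ (hvpos q hq)]
  exact mul_le_of_le_one_right (deriv_nonneg_of_strictMonoOn hm hq)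
    (hv.le_one hF (Ioo_subset_Ico_self hq))

end Auction

end BidInference

theorem mainTheorem12 :
    ∃ C : ℝ, 0 < C ∧
      -- the estimator, for an arbitrary bid distribution `ν` with bid function `b`
      (∀ (ν : Measure ℝ) [IsProbabilityMeasure ν] (b : ℝ → ℝ),
        BidInference.IsQuantileFunction ν b → ContDiffOn ℝ 1 b (Icc 0 1) →
          BidInference.HasConvergenceRate (fun N => √(N : ℝ)) (BidInference.mse ν b) ∧
          ∀ N : ℕ, 1 ≤ N → BidInference.mse ν b N ≤
            ENNReal.ofReal C * BidInference.quantileSup (fun q => deriv b q)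
              / ENNReal.ofReal √(2 * (N : ℝ))) ∧
      -- bids from a symmetric equilibrium `s` of a rank-based auction, `b = s ∘ v`
      (∀ (n : ℕ) (_ : 2 ≤ n) (w : Fin n → ℝ) (_ : ∀ k, w k ∈ Icc (0 : ℝ) 1) (_ : w ≠ 0)
        (F : Measure ℝ) [IsProbabilityMeasure F] (_ : F (Icc 0 1) = 1)
        (v : ℝ → ℝ) (_ : BidInference.IsQuantileFunction F v)
        (s : ℝ → ℝ) (_ : Measurable s)
        (_ : StrictMonoOn (fun q => s (v q)) (Icc 0 1))
        (_ : ContDiffOn ℝ 1 (fun q => s (v q)) (Icc 0 1))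
        (i : Fin n),
        -- (i) the first-price format
        (BidInference.IsBayesNash (BidInference.firstPrice w) F (fun _ => s) →
          ∀ N : ℕ, 1 ≤ N → BidInference.mse (F.map s) (fun q => s (v q)) N ≤
            ENNReal.ofReal C *
              BidInference.quantileSup (fun q =>
                deriv (BidInference.quantileAlloc (BidInference.firstPrice w) F s v i) q
                  / BidInference.quantileAlloc (BidInference.firstPrice w) F s v i q)
              / ENNReal.ofReal √(2 * (N : ℝ))) ∧
        -- (ii) the all-pay format
        (BidInference.IsBayesNash (BidInference.allPay w) F (fun _ => s) →
          ∀ N : ℕ, 1 ≤ N → BidInference.mse (F.map s) (fun q => s (v q)) N ≤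
            ENNReal.ofReal C *
              BidInference.quantileSup (fun q =>
                deriv (BidInference.quantileAlloc (BidInference.allPay w) F s v i) q)
              / ENNReal.ofReal √(2 * (N : ℝ)))) := by
  refine ⟨9, by norm_num, fun ν _ b hb hd =>
    ⟨BidInference.hasConvergenceRate_mse hb hd, fun N hN =>
      BidInference.mse_le_quantileSup_deriv hb hd hN⟩, ?_⟩
  intro n _ w hw hw0 F _ hF v hv s hs hm hd i
  have hprob := Measure.isProbabilityMeasure_map (μ := F) hs.aemeasurable
  have hb := hv.map hs hm hd.continuousOn
  refine ⟨fun hBN N hN => (BidInference.mse_le_quantileSup_deriv hb hd hN).trans ?_,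
    fun hBN N hN => (BidInference.mse_le_quantileSup_deriv hb hd hN).trans ?_⟩
  · gcongr
    exact BidInference.quantileSup_deriv_bid_le_firstPrice hw hw0 hF hv hs hm hd i hBN
  · gcongr
    exact BidInference.quantileSup_deriv_bid_le_allPay hF hv hm hd i hBN
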